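/- An $(n,3,2)$-covering is a pair $(X,\mathcal A)$, where $X$ is a set of $n$ points and $\mathcal A$ is a set of $3$-subsets of $X$, called blocks, such that every $2$-subset of $X$ is contained in at least one block. Let $C(n,3,2)$ be the minimum of $|\mathcal A|$ over all $(n,3,2)$-coverings; a covering with $|\mathcal A|=C(n,3,2)$ is called minimum. The edge-colored block intersection graph of $(X,\mathcal A)$ is the loopless multigraph with vertex set $\mathcal A$ in which any two distinct blocks $A,B$ are joined by exactly $|A\cap B|$ parallel edges, colored by the distinct points of $A\cap B$. A hamiltonian cycle of this multigraph is alternating if any two adjacent (consecutive) edges of the cycle have distinct colors. The covering is called alternating hamiltonian if its edge-colored block intersection graph has an alternating hamiltonian cycle, where by convention a covering with a single block is (trivially) alternating hamiltonian. Theorem. For every integer $n\ge 3$ there exists an alternating hamiltonian minimum $(n,3,2)$-covering, and its size is $$C(n,3,2)=\left\lceil \frac n3\left\lceil\frac{n-1}2\right\rceil\right\rceil .$$ For $n\ge 4$ the alternating hamiltonian cycle is a genuine cycle; the convention is used only for $n=3$. -/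

import Mathlib

namespace PairCovering

/-- An `(n,3,2)`-covering on the point set `X` (with `n = |X|`): a set `𝒜` of blocks, each of size
three, such that every 2-subset of `X` is contained in at least one block. -/
def IsCovering {X : Type*} (𝒜 : Finset (Finset X)) : Prop :=
  (∀ A ∈ 𝒜, A.card = 3) ∧ ∀ T : Finset X, T.card = 2 → ∃ A ∈ 𝒜, T ⊆ A

/-- The covering number `C(n,3,2)`: the minimum size of an `(n,3,2)`-covering. (For `n ≥ 3` such
coverings exist: take all triples.) -/
noncomputable def coveringNumber (n : ℕ) : ℕ :=
  sInf {k | ∃ 𝒜 : Finset (Finset (Fin n)), IsCovering 𝒜 ∧ 𝒜.card = k}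

/-- A minimum `(n,3,2)`-covering: one of size `C(n,3,2)`. -/
def IsMinimumCovering {n : ℕ} (𝒜 : Finset (Finset (Fin n))) : Prop :=
  IsCovering 𝒜 ∧ 𝒜.card = coveringNumber n

/-- The block intersection graph of a set system with block set `𝒜`: the loopless multigraph whose
vertices are the blocks, with exactly `|A ∩ B|` parallel edges between distinct blocks `A` and `B`,
namely the edges `(s(A, B), x)` for `x ∈ A ∩ B`. -/
def blockIntersectionGraph {X : Type*} (𝒜 : Finset (Finset X)) :
    Graph (Finset X) (Sym2 (Finset X) × X) where
  vertexSet := {A | A ∈ 𝒜}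
  IsLink e A B := e.1 = s(A, B) ∧ A ∈ 𝒜 ∧ B ∈ 𝒜 ∧ A ≠ B ∧ e.2 ∈ A ∧ e.2 ∈ B
  isLink_symm := by
    rintro e -
    exact ⟨fun A B ⟨h, hA, hB, hne, h1, h2⟩ =>
      ⟨h.trans Sym2.eq_swap, hB, hA, hne.symm, h2, h1⟩⟩
  eq_or_eq_of_isLink_of_isLink := by
    rintro e A B C D ⟨h, -⟩ ⟨h', -⟩
    rcases Sym2.eq_iff.1 (h.symm.trans h') with ⟨h, -⟩ | ⟨h, -⟩
    · exact Or.inl h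
    · exact Or.inr h
  left_mem_of_isLink := by
    rintro e A B ⟨-, hA, -⟩
    exact hA

/-- The edge coloring of the block intersection graph: the parallel edges between `A` and `B`
receive distinct colors, which are the points of `A ∩ B`. -/
def edgeColor {X : Type*} (e : Sym2 (Finset X) × X) : X := e.2

/-- The cyclic sequence `v 0, e 0, v 1, e 1, …, v (m-1), e (m-1), v 0` (indices modulo `m ≥ 2`) is a
hamiltonian cycle of the multigraph `G`: it visits every vertex of `G` exactly once, its edges are
distinct, and `e i` joins `v i` to `v (i + 1)`. -/
structure IsHamiltonianCycle {α β : Type*} (G : Graph α β) (m : ℕ)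
    (v : ZMod m → α) (e : ZMod m → β) : Prop where
  two_le : 2 ≤ m
  vertex_injective : Function.Injective v
  range_vertex : Set.range v = G.vertexSet
  edge_injective : Function.Injective e
  isLink : ∀ i, G.IsLink (e i) (v i) (v (i + 1))

/-- The edge-colored multigraph `(G, χ)` has an alternating hamiltonian cycle: a hamiltonian cycle
in which adjacent edges have distinct colors. -/
def HasAlternatingHamiltonianCycle {α β γ : Type*} (G : Graph α β) (χ : β → γ) : Prop :=
  ∃ (m : ℕ) (v : ZMod m → α) (e : ZMod m → β),
    IsHamiltonianCycle G m v e ∧ ∀ i, χ (e i) ≠ χ (e (i + 1))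

/-- A set system is alternating hamiltonian if its edge-colored block intersection graph has an
alternating hamiltonian cycle. By convention a system with a single block is (trivially)
alternating hamiltonian: its one-vertex graph counts as a degenerate cycle without edges. -/
def IsAlternatingHamiltonian {X : Type*} (𝒜 : Finset (Finset X)) : Prop :=
  𝒜.card = 1 ∨ HasAlternatingHamiltonianCycle (blockIntersectionGraph 𝒜) edgeColor

end PairCovering

namespace PairCovering

/-! The lower bound is a double count: each point needs at least `n / 2` blocks, so `3 * |𝒜| ≥ n *
(n / 2)`. An alternating hamiltonian cycle amounts to a cyclic order of the blocks with a color
chosen at each passage; consecutive colors are two different points of one block. So it suffices to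
choose a pair from each triple in such a way that the chosen pairs are the edges of a connected even
multigraph: an Euler tour of it (`exists_euler_tour`) orders the blocks
(`hasAlternatingMinimumCovering_of_tour`).

To make that choice, split the triples `{p, q, r}` into two colors so that the pairs `qr` of each
color connect all points (`Linked`). Triples of color `true` contribute `qr`, which secures
connectedness. A triple of color `false` contributes `pq` or `pr`, and switching between them
changes the degree parities exactly at `q` and `r`. As the pairs `qr` of color `false` are
connected, some set of switches (a T-join) makes all degrees even (`exists_tour`).

It remains to find coverings of Schönheim size with such a coloring. For `n ≥ 15` and odd they come
from the Bose construction, a twisted variant with one block of size five, and the Skolem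
construction. All three contain the triples `{(a, j), (b, j), (f j a b, j + 1)}` on three levels,
which alone are linked in both colors (`levels_linked`). One block is left out as a hole and filled
by a small covering. For even `n` a new point is joined to a perfect matching of the points outside
the hole, and the hole is filled together with the new point. The cases `4 ≤ n ≤ 14` are explicit
tours, and `n = 3` is a single block. -/

/-- The Schönheim bound `⌈n/3 ⌈(n-1)/2⌉⌉` in natural number arithmetic. -/
def schoenheim (n : ℕ) : ℕ := (n * (n / 2) + 2) / 3

theorem ceil_eq_schoenheim (n : ℕ) :
    ⌈(n : ℚ) / 3 * (⌈((n : ℚ) - 1) / 2⌉ : ℚ)⌉ = (schoenheim n : ℤ) := by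
  have h1 : ⌈((n : ℚ) - 1) / 2⌉ = ((n / 2 : ℕ) : ℤ) := by
    rw [Int.ceil_eq_iff]
    have h2 : (n : ℚ) = 2 * (n / 2 : ℕ) + (n % 2 : ℕ) := by exact_mod_cast (Nat.div_add_mod n 2).symm
    rw [Int.cast_natCast]
    rcases Nat.mod_two_eq_zero_or_one n with h | h <;>
      simp only [h, Nat.cast_zero, Nat.cast_one] at h2 <;> constructor <;> linarith
  rw [h1, Int.ceil_eq_iff]
  set k := n * (n / 2) with hk
  have h3 : (n : ℚ) / 3 * (((n / 2 : ℕ) : ℤ) : ℚ) = (k : ℚ) / 3 := by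
    rw [hk, Int.cast_natCast, Nat.cast_mul]; ring
  rw [h3]
  have h4 : schoenheim n = (k + 2) / 3 := rfl
  rw [h4]
  have h5 : 3 * ((k + 2) / 3) < k + 3 := by omega
  have h6 : k ≤ 3 * ((k + 2) / 3) := by omega
  have h5' : (3 : ℚ) * ((k + 2) / 3 : ℕ) < k + 3 := by exact_mod_cast h5
  have h6' : (k : ℚ) ≤ 3 * ((k + 2) / 3 : ℕ) := by exact_mod_cast h6
  constructor
  · rw [Int.cast_natCast]; linarith
  · rw [Int.cast_natCast]; linarith

/-! ### The Schönheim lower bound -/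

theorem IsCovering.le_two_mul_card_filter_mem {n : ℕ} {𝒜 : Finset (Finset (Fin n))}
    (h : IsCovering 𝒜) (x : Fin n) : n - 1 ≤ 2 * (𝒜.filter (x ∈ ·)).card := by
  -- The blocks through `x`, with `x` removed, are pairs that together contain all other points.
  have h1 : (Finset.univ.erase x) ⊆ (𝒜.filter (x ∈ ·)).biUnion (fun A => A.erase x) := by
    intro y hy
    have hne : y ≠ x := (Finset.mem_erase.1 hy).1
    obtain ⟨A, hA, hs⟩ := h.2 {x, y} (Finset.card_pair hne.symm)
    simp only [Finset.mem_biUnion, Finset.mem_filter, Finset.mem_erase]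
    exact ⟨A, ⟨hA, hs (by simp)⟩, hne, hs (by simp)⟩
  have h2 := Finset.card_le_card h1
  rw [Finset.card_erase_of_mem (Finset.mem_univ x), Finset.card_univ, Fintype.card_fin] at h2
  refine h2.trans ((Finset.card_biUnion_le_card_mul _ _ 2 ?_).trans (by rw [mul_comm]))
  intro A hA
  rw [Finset.mem_filter] at hA
  rw [Finset.card_erase_of_mem hA.2, h.1 A hA.1]

theorem IsCovering.schoenheim_le_card {n : ℕ} {𝒜 : Finset (Finset (Fin n))}
    (h : IsCovering 𝒜) : schoenheim n ≤ 𝒜.card := by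
  have h1 : ∑ x : Fin n, (𝒜.filter (x ∈ ·)).card = 3 * 𝒜.card := by
    have hdc := Finset.sum_card_bipartiteAbove_eq_sum_card_bipartiteBelow (s := Finset.univ)
      (t := 𝒜) (fun (x : Fin n) A => x ∈ A)
    simp only [Finset.bipartiteAbove] at hdc
    rw [hdc, Finset.sum_congr rfl (g := fun _ => 3), Finset.sum_const, smul_eq_mul, mul_comm]
    intro A hA
    rw [← h.1 A hA]
    congr 1
    ext x
    simp [Finset.bipartiteBelow]
  have h2 : n * (n / 2) ≤ ∑ x : Fin n, (𝒜.filter (x ∈ ·)).card := by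
    calc n * (n / 2) = ∑ _x : Fin n, n / 2 := by simp
      _ ≤ _ := Finset.sum_le_sum fun x _ => by
        have := h.le_two_mul_card_filter_mem x
        omega
  unfold schoenheim
  omega

/-- The conclusion of the main theorem for `n` points. -/
def HasAlternatingMinimumCovering (n : ℕ) : Prop :=
  ∃ 𝒜 : Finset (Finset (Fin n)),
    IsMinimumCovering 𝒜 ∧
    (𝒜.card : ℤ) = ⌈(n : ℚ) / 3 * (⌈((n : ℚ) - 1) / 2⌉ : ℚ)⌉ ∧
    IsAlternatingHamiltonian 𝒜 ∧
    (4 ≤ n → HasAlternatingHamiltonianCycle (blockIntersectionGraph 𝒜) edgeColor)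

theorem IsCovering.isMinimumCovering {n : ℕ} {𝒜 : Finset (Finset (Fin n))}
    (h : IsCovering 𝒜) (hc : 𝒜.card = schoenheim n) : IsMinimumCovering 𝒜 := by
  refine ⟨h, le_antisymm ?_ (Nat.sInf_le ⟨𝒜, h, rfl⟩)⟩
  refine le_csInf ⟨_, 𝒜, h, rfl⟩ ?_
  rintro k ⟨ℬ, hℬ, rfl⟩
  rw [hc]
  exact hℬ.schoenheim_le_card

/-! ### Alternating cycles from closed tours -/

/-- A closed walk `x 0, x 1, …, x m = x 0` together with points `z i` completing its steps to the
triples of a covering of the right size. -/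
theorem hasAlternatingMinimumCovering_of_tour {n : ℕ} (m : ℕ) (hm : m = schoenheim n)
    (hm2 : 2 ≤ m) (x z : ℕ → Fin n) (hx : x m = x 0)
    (hne : ∀ i < m, x i ≠ x (i + 1) ∧ z i ≠ x i ∧ z i ≠ x (i + 1))
    (hcov : ∀ a b : Fin n, a ≠ b → ∃ i < m, (a = x i ∨ a = x (i + 1) ∨ a = z i) ∧
      (b = x i ∨ b = x (i + 1) ∨ b = z i)) :
    HasAlternatingMinimumCovering n := by
  classical
  set B : ℕ → Finset (Fin n) := fun i => {x i, x (i + 1), z i} with hB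
  set 𝒜 := (Finset.range m).image B with h𝒜
  have hcover : IsCovering 𝒜 := by
    constructor
    · intro A hA
      obtain ⟨i, hi, rfl⟩ := Finset.mem_image.1 hA
      obtain ⟨h1, h2, h3⟩ := hne i (Finset.mem_range.1 hi)
      exact Finset.card_eq_three.2 ⟨_, _, _, h1, h2.symm, h3.symm, rfl⟩
    · intro T hT
      obtain ⟨a, b, hab, rfl⟩ := Finset.card_eq_two.1 hT
      obtain ⟨i, hi, ha, hb⟩ := hcov a b hab
      refine ⟨B i, Finset.mem_image_of_mem _ (Finset.mem_range.2 hi), ?_⟩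
      intro c hc
      simp only [Finset.mem_insert, Finset.mem_singleton, hB] at hc ⊢
      rcases hc with rfl | rfl <;> assumption
  -- The lower bound forces the `m` triples to be distinct, so distinctness need not be assumed.
  have hcard : 𝒜.card = m := by
    refine le_antisymm ?_ (hm ▸ hcover.schoenheim_le_card)
    exact Finset.card_image_le.trans (by simp)
  have hinj : Set.InjOn B (Finset.range m) :=
    Finset.card_image_iff.1 (by rw [← h𝒜, hcard, Finset.card_range])
  have : NeZero m := ⟨by omega⟩
  have hval : ∀ i : ZMod m, x (i + 1).val = x (i.val + 1) := by
    intro i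
    rcases Nat.lt_or_ge (i.val + 1) m with h | h
    · have : Fact (1 < m) := ⟨by omega⟩
      rw [ZMod.val_add_of_lt (by rwa [ZMod.val_one]), ZMod.val_one]
    · have h' : i.val + 1 = m := le_antisymm (ZMod.val_lt i) h
      have : i + 1 = 0 := by
        have := congrArg (Nat.cast : ℕ → ZMod m) h'
        simpa using this
      rw [this, h', hx, ZMod.val_zero]
  have hvinj : Function.Injective fun i : ZMod m => B i.val := fun i j h =>
    ZMod.val_injective m (hinj (by simpa using ZMod.val_lt i) (by simpa using ZMod.val_lt j) h)
  have hmem : ∀ i : ZMod m, B i.val ∈ 𝒜 := fun i =>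
    Finset.mem_image_of_mem _ (Finset.mem_range.2 (ZMod.val_lt i))
  have hcol : ∀ i : ZMod m, x (i.val + 1) ≠ x ((i + 1).val + 1) := fun i => by
    rw [← hval i]
    exact (hne _ (ZMod.val_lt _)).1
  have hone : (1 : ZMod m) ≠ 0 := by
    have : Fact (1 < m) := ⟨by omega⟩
    exact one_ne_zero
  have hham : HasAlternatingHamiltonianCycle (blockIntersectionGraph 𝒜) edgeColor := by
    refine ⟨m, fun i => B i.val, fun i => (s(B i.val, B (i + 1).val), x (i.val + 1)),
      ⟨hm2, hvinj, ?_, ?_, ?_⟩, hcol⟩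
    · ext A
      constructor
      · rintro ⟨i, rfl⟩
        exact hmem i
      · intro hA
        obtain ⟨i, hi, rfl⟩ := Finset.mem_image.1 (show A ∈ 𝒜 from hA)
        exact ⟨(i : ZMod m), by simp only [ZMod.val_cast_of_lt (Finset.mem_range.1 hi)]⟩
    · intro i j h
      obtain ⟨h1, h2⟩ := Prod.mk.inj h
      rcases Sym2.eq_iff.1 h1 with ⟨h3, -⟩ | ⟨-, h3⟩
      · exact hvinj h3
      -- Two passages with the same two blocks in opposite order occur only for `m = 2`; then the
      -- two parallel edges are told apart by their colors.
      · have : i + 1 = j := hvinj h3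
        subst this
        exact absurd h2 (hcol i)
    · intro i
      refine ⟨rfl, hmem i, hmem _, fun h => ?_, by simp [hB], ?_⟩
      · have := hvinj h
        exact hone (by simpa using this)
      · simp only [hB, ← hval i, Finset.mem_insert, true_or]
  exact ⟨𝒜, hcover.isMinimumCovering (hcard.trans hm), by rw [ceil_eq_schoenheim, hcard, hm],
    Or.inr hham, fun _ => hham⟩

theorem hasAlternatingMinimumCovering_three : HasAlternatingMinimumCovering 3 := by
  have hcover : IsCovering ({Finset.univ} : Finset (Finset (Fin 3))) :=
    ⟨by simp, fun T _ => ⟨Finset.univ, by simp, Finset.subset_univ T⟩⟩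
  refine ⟨{Finset.univ}, hcover.isMinimumCovering rfl, ?_, Or.inl rfl, by omega⟩
  rw [ceil_eq_schoenheim]
  rfl

/-! ### Euler tours of multigraphs -/

section Euler

variable {X ι : Type*} (a b : ι → X)

/-- `IsWalk a b u l v`: in the multigraph whose edge `i` joins `a i` and `b i`, the list `l` of edges
forms a walk from `u` to `v`. -/
def IsWalk : X → List ι → X → Prop
  | u, [], v => u = v
  | u, i :: l, v => ∃ w, ((u = a i ∧ w = b i) ∨ (u = b i ∧ w = a i)) ∧ IsWalk w l v

variable {a b}

theorem isWalk_append {u v : X} {l₁ l₂ : List ι} :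
    IsWalk a b u (l₁ ++ l₂) v ↔ ∃ w, IsWalk a b u l₁ w ∧ IsWalk a b w l₂ v := by
  induction l₁ generalizing u with
  | nil => simp [IsWalk]
  | cons i l ih =>
    simp only [List.cons_append, IsWalk, ih]
    constructor
    · rintro ⟨w, h, w', h1, h2⟩
      exact ⟨w', ⟨w, h, h1⟩, h2⟩
    · rintro ⟨w', ⟨w, h, h1⟩, h2⟩
      exact ⟨w, h, w', h1, h2⟩

theorem isWalk_singleton {u v : X} {i : ι} :
    IsWalk a b u [i] v ↔ (u = a i ∧ v = b i) ∨ (u = b i ∧ v = a i) := by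
  simp [IsWalk]

/-- The incidence of edge `i` and vertex `x`, modulo two. -/
def incidence [DecidableEq X] (a b : ι → X) (i : ι) (x : X) : ZMod 2 :=
  (if a i = x then 1 else 0) + (if b i = x then 1 else 0)

/-- Each inner visit uses two edge ends, so modulo two only the end points of the walk survive. -/
theorem IsWalk.sum_incidence [DecidableEq X] {u v : X} {l : List ι} (h : IsWalk a b u l v) (x : X) :
    (l.map fun i => incidence a b i x).sum
      = (if u = x then 1 else 0) + (if v = x then 1 else 0) := by
  induction l generalizing u with
  | nil =>
    obtain rfl : u = v := h
    simp [CharTwo.add_self_eq_zero]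
  | cons i l ih =>
    obtain ⟨w, h, h'⟩ := h
    rw [List.map_cons, List.sum_cons, ih h', incidence]
    have key : ∀ s t r : ZMod 2, s + t + (t + r) = s + r := by decide
    rcases h with ⟨rfl, rfl⟩ | ⟨rfl, rfl⟩
    · exact key _ _ _
    · rw [add_comm (if a i = x then (1 : ZMod 2) else 0)]
      exact key _ _ _

theorem IsWalk.exists_vertices {u v : X} {l : List ι} (h : IsWalk a b u l v) :
    ∃ x : ℕ → X, x 0 = u ∧ x l.length = v ∧ ∀ (i : ℕ) (hi : i < l.length),
      (x i = a l[i] ∧ x (i + 1) = b l[i]) ∨ (x i = b l[i] ∧ x (i + 1) = a l[i]) := by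
  induction l generalizing u with
  | nil => exact ⟨fun _ => u, rfl, h, fun i hi => by simp at hi⟩
  | cons i l ih =>
    obtain ⟨w, hw, h'⟩ := h
    obtain ⟨x, h0, h1, h2⟩ := ih h'
    refine ⟨fun k => Nat.casesOn k u x, rfl, h1, ?_⟩
    intro k hk
    cases k with
    | zero => simpa [h0] using hw
    | succ k => simpa using h2 k (by simpa using hk)

/-- A connected multigraph all of whose degrees are even has a closed Euler tour. Connectedness is
expressed by cuts. -/
theorem exists_euler_tour [Fintype ι] [DecidableEq X] [Nonempty X]
    (heven : ∀ x, ∑ i, incidence a b i x = 0)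
    (hconn : ∀ S : X → Prop, (∀ i, S (a i) ↔ S (b i)) → ∀ x y, S x → S y) :
    ∃ (u : X) (l : List ι), IsWalk a b u l u ∧ l.Nodup ∧ ∀ i, i ∈ l := by
  -- Take a longest trail `l`. It is closed by parity, and by connectedness it misses no edge.
  classical
  obtain ⟨m, ⟨l, hl, u, v, hw, rfl⟩, hmax⟩ : ∃ m, (∃ l : List ι, l.Nodup ∧ ∃ u v, IsWalk a b u l v ∧
      l.length = m) ∧ ∀ l : List ι, l.Nodup → ∀ u v, IsWalk a b u l v → l.length ≤ m := by
    let P : ℕ → Prop := fun m => ∃ l : List ι, l.Nodup ∧ ∃ u v, IsWalk a b u l v ∧ l.length = m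
    have h0 : P 0 := ⟨[], List.nodup_nil, Classical.arbitrary X, _, rfl, rfl⟩
    have hb : ∀ l : List ι, l.Nodup → l.length ≤ Fintype.card ι := fun l hl => hl.length_le_card
    refine ⟨Nat.findGreatest P (Fintype.card ι), Nat.findGreatest_spec (P := P) (Nat.zero_le _) h0,
      fun l hl u v hw => Nat.le_findGreatest (hb l hl) ⟨l, hl, u, v, hw, rfl⟩⟩
  -- Stated for every rearrangement of `l` into a trail, because a closed trail is later rotated to
  -- end at any of its vertices.
  have hext : ∀ (l' : List ι) (u' v' : X), IsWalk a b u' l' v' → l'.Perm l → ∀ i, i ∉ l →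
      v' ≠ a i ∧ v' ≠ b i := by
    intro l' u' v' hw' hp i hi
    by_contra hc
    obtain ⟨w, hw2⟩ : ∃ w, IsWalk a b v' [i] w := by
      by_cases h : v' = a i
      · exact ⟨b i, isWalk_singleton.2 (Or.inl ⟨h, rfl⟩)⟩
      · exact ⟨a i, isWalk_singleton.2 (Or.inr ⟨by tauto, rfl⟩)⟩
    have h1 := hmax (l' ++ [i]) (by
      rw [List.nodup_append_comm]
      simpa using ⟨fun h => hi (hp.mem_iff.1 h), hp.nodup_iff.2 hl⟩) u' w
      (isWalk_append.2 ⟨v', hw', hw2⟩)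
    rw [List.length_append, hp.length_eq] at h1
    simp at h1
  -- If the trail were open, its edges would give `v` odd degree, while by `hext` no unused edge
  -- meets `v`.
  obtain rfl : u = v := by
    by_contra huv
    have h1 := hw.sum_incidence v
    rw [if_neg huv, if_pos rfl, zero_add, ← List.sum_toFinset _ hl] at h1
    have h2 := heven v
    rw [← Finset.sum_subset (Finset.subset_univ l.toFinset), h1] at h2
    · exact one_ne_zero h2
    · intro i _ hi
      obtain ⟨h3, h4⟩ := hext l u v hw (List.Perm.refl l) i (by simpa using hi)
      simp [incidence, h3.symm, h4.symm]
  refine ⟨u, l, hw, hl, fun i₀ => ?_⟩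
  by_contra hi₀
  -- The vertices on the trail. Rotation and `hext` show that no unused edge meets `S`, so `S` is a
  -- cut that no edge crosses.
  let S : X → Prop := fun x => ∃ l₁ l₂, l = l₁ ++ l₂ ∧ IsWalk a b u l₁ x ∧ IsWalk a b x l₂ u
  have hout : ∀ i, i ∉ l → ∀ x, S x → x ≠ a i ∧ x ≠ b i := by
    rintro i hi x ⟨l₁, l₂, rfl, h1, h2⟩
    exact hext (l₂ ++ l₁) x x (isWalk_append.2 ⟨u, h2, h1⟩) List.perm_append_comm i hi
  have hin : ∀ i, i ∈ l → S (a i) ∧ S (b i) := by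
    intro i hi
    obtain ⟨l₁, l₂, hl12⟩ := List.append_of_mem hi
    rw [hl12] at hw
    obtain ⟨w, h1, w', h2, h3⟩ := isWalk_append.1 hw
    have hS1 : S w := ⟨l₁, i :: l₂, hl12, h1, w', h2, h3⟩
    have hS2 : S w' := ⟨l₁ ++ [i], l₂, by simp [hl12],
      isWalk_append.2 ⟨w, h1, isWalk_singleton.2 h2⟩, h3⟩
    rcases h2 with ⟨rfl, rfl⟩ | ⟨rfl, rfl⟩
    · exact ⟨hS1, hS2⟩
    · exact ⟨hS2, hS1⟩
  have hall := hconn S (fun i => by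
    by_cases hi : i ∈ l
    · exact iff_of_true (hin i hi).1 (hin i hi).2
    · exact iff_of_false (fun h => (hout i hi _ h).1 rfl) (fun h => (hout i hi _ h).2 rfl))
    u (a i₀) ⟨[], l, rfl, rfl, hw⟩
  exact (hout i₀ hi₀ _ hall).1 rfl

end Euler

/-! ### Explicit tours for small `n` -/

/-- The steps `(x, x', z)` of a list, each leading from `x` to `x'`, fit together and end at `e`. -/
def stepsFit (e : ℕ) : List (ℕ × ℕ × ℕ) → Bool
  | [] => true
  | [t] => t.2.1.beq e
  | t :: t' :: l => t.2.1.beq t'.1 && stepsFit e (t' :: l)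

theorem step_eq_of_stepsFit {e : ℕ} {T : List (ℕ × ℕ × ℕ)} (h : stepsFit e T = true) (i : ℕ)
    (hi : i < T.length) : (T[i]).2.1 = if hi' : i + 1 < T.length then (T[i + 1]).1 else e := by
  induction T generalizing i with
  | nil => simp at hi
  | cons t l ih =>
    cases l with
    | nil =>
      obtain rfl : i = 0 := by simpa using hi
      simpa [stepsFit] using h
    | cons t' l =>
      rw [stepsFit, Bool.and_eq_true] at h
      cases i with
      | zero => simpa using h.1
      | succ i => simpa using ih h.2 i (by simpa using hi)

/-- Membership of a point in the triple of a step. -/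
def memStep (a : ℕ) (t : ℕ × ℕ × ℕ) : Bool := a.beq t.1 || (a.beq t.2.1 || a.beq t.2.2)

/-- The step `(x, x', z)` consists of three different points below `n`. -/
def stepValid (n : ℕ) (t : ℕ × ℕ × ℕ) : Bool :=
  (t.1.blt n && t.2.2.blt n) && (!t.1.beq t.2.1 && (!t.2.2.beq t.1 && !t.2.2.beq t.2.1))

/-- A closed tour given as a list of steps `(x, x', z)` from `x` to `x'` through the triple
`{x, x', z}`. -/
theorem hasAlternatingMinimumCovering_of_list {n : ℕ} (T : List (ℕ × ℕ × ℕ)) (hn : 0 < n)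
    (hm : T.length = schoenheim n) (hm2 : 2 ≤ T.length)
    (hfit : stepsFit (T.headD (0, 0, 0)).1 T = true) (hval : T.all (stepValid n) = true)
    (hcov : ((List.range n).all fun a => (List.range a).all fun b =>
      T.any fun t => memStep a t && memStep b t) = true) :
    HasAlternatingMinimumCovering n := by
  have : NeZero n := ⟨by omega⟩
  set e := (T.headD (0, 0, 0)).1 with he
  -- The default `e` is the starting point, so that index `T.length` closes the tour.
  let x : ℕ → ℕ := fun i => if hi : i < T.length then (T[i]).1 else e
  let z : ℕ → ℕ := fun i => if hi : i < T.length then (T[i]).2.2 else 0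
  have hx : ∀ i (hi : i < T.length), x i = (T[i]).1 := fun i hi => dif_pos hi
  have hx' : ∀ i (hi : i < T.length), x (i + 1) = (T[i]).2.1 := fun i hi =>
    (step_eq_of_stepsFit hfit i hi).symm
  have hz : ∀ i (hi : i < T.length), z i = (T[i]).2.2 := fun i hi => dif_pos hi
  have hv : ∀ i < T.length, (x i < n ∧ z i < n) ∧ x i ≠ x (i + 1) ∧ z i ≠ x i ∧
      z i ≠ x (i + 1) := by
    intro i hi
    have := List.all_eq_true.1 hval _ (List.getElem_mem hi)
    rw [hx i hi, hx' i hi, hz i hi]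
    have hb : ∀ a b : ℕ, a.beq b = false ↔ a ≠ b := fun a b => by rw [← Bool.not_eq_true, Nat.beq_eq]
    simpa [stepValid, Nat.blt_eq, hb] using this
  have hx0 : x 0 = e := by
    rw [hx 0 (by omega), he]
    cases T with
    | nil => simp at hm2
    | cons t l => rfl
  have hxm : x T.length = e := dif_neg (lt_irrefl _)
  have hxlt : ∀ i ≤ T.length, x i < n := by
    intro i hi
    rcases hi.lt_or_eq with h | h
    · exact (hv i h).1.1
    · rw [h, hxm, ← hx0]
      exact (hv 0 (by omega)).1.1
  have hcast : ∀ i < n, ∀ j < n, (Fin.ofNat n i = Fin.ofNat n j ↔ i = j) := by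
    intro i hi j hj
    rw [Fin.ext_iff, Fin.val_ofNat, Fin.val_ofNat, Nat.mod_eq_of_lt hi, Nat.mod_eq_of_lt hj]
  have hself : ∀ a : Fin n, Fin.ofNat n a.val = a := fun a => Fin.ofNat_val_eq_self a
  have hcov' : ∀ a b : Fin n, b < a → ∃ i < T.length,
      (a = Fin.ofNat n (x i) ∨ a = Fin.ofNat n (x (i + 1)) ∨ a = Fin.ofNat n (z i)) ∧
      (b = Fin.ofNat n (x i) ∨ b = Fin.ofNat n (x (i + 1)) ∨ b = Fin.ofNat n (z i)) := by
    intro a b hab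
    have h1 := List.all_eq_true.1 hcov a.val (List.mem_range.2 a.isLt)
    have h2 := List.all_eq_true.1 h1 b.val (List.mem_range.2 hab)
    obtain ⟨t, ht, h3⟩ := List.any_eq_true.1 h2
    obtain ⟨i, hi, rfl⟩ := List.mem_iff_getElem.1 ht
    refine ⟨i, hi, ?_⟩
    rw [hx i hi, hx' i hi, hz i hi]
    simp only [memStep, Bool.and_eq_true, Bool.or_eq_true, Nat.beq_eq] at h3
    obtain ⟨h4, h5⟩ := h3
    constructor
    · rcases h4 with h | h | h <;> rw [← h, hself] <;> simp
    · rcases h5 with h | h | h <;> rw [← h, hself] <;> simp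
  refine hasAlternatingMinimumCovering_of_tour T.length hm hm2 (fun i => Fin.ofNat n (x i))
    (fun i => Fin.ofNat n (z i)) (by rw [hx0, hxm]) ?_ ?_
  · intro i hi
    obtain ⟨⟨h1, h2⟩, h3, h4, h5⟩ := hv i hi
    have h6 := hxlt (i + 1) hi
    simp only [ne_eq, hcast _ h1 _ h6, hcast _ h2 _ h1, hcast _ h2 _ h6]
    exact ⟨h3, h4, h5⟩
  · intro a b hab
    rcases lt_or_gt_of_ne hab with h | h
    · obtain ⟨i, hi, h1, h2⟩ := hcov' b a h
      exact ⟨i, hi, h2, h1⟩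
    · exact hcov' a b h

theorem hasAlternatingMinimumCovering_four : HasAlternatingMinimumCovering 4 :=
  hasAlternatingMinimumCovering_of_list
    [(0, 2, 3), (2, 1, 0), (1, 0, 3)]
    (by decide) rfl (by decide) rfl rfl (by decide +kernel)

theorem hasAlternatingMinimumCovering_five : HasAlternatingMinimumCovering 5 :=
  hasAlternatingMinimumCovering_of_list
    [(1, 0, 3), (0, 4, 1), (4, 2, 3), (2, 1, 0)]
    (by decide) rfl (by decide) rfl rfl (by decide +kernel)

theorem hasAlternatingMinimumCovering_six : HasAlternatingMinimumCovering 6 :=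
  hasAlternatingMinimumCovering_of_list
    [(1, 5, 4), (5, 3, 2), (3, 0, 1), (0, 4, 5), (4, 2, 3), (2, 1, 0)]
    (by decide) rfl (by decide) rfl rfl (by decide +kernel)

theorem hasAlternatingMinimumCovering_seven : HasAlternatingMinimumCovering 7 :=
  hasAlternatingMinimumCovering_of_list
    [(1, 0, 3), (0, 6, 2), (6, 5, 1), (5, 4, 0), (4, 3, 6), (3, 2, 5), (2, 1, 4)]
    (by decide) rfl (by decide) rfl rfl (by decide +kernel)

theorem hasAlternatingMinimumCovering_eight : HasAlternatingMinimumCovering 8 :=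
  hasAlternatingMinimumCovering_of_list
    [(1, 3, 0), (3, 0, 7), (0, 4, 5), (4, 2, 7), (2, 6, 0), (6, 1, 5), (1, 7, 0), (7, 5, 6),
      (5, 3, 2), (3, 4, 6), (4, 1, 2)]
    (by decide) rfl (by decide) rfl rfl (by decide +kernel)

theorem hasAlternatingMinimumCovering_nine : HasAlternatingMinimumCovering 9 :=
  hasAlternatingMinimumCovering_of_list
    [(4, 6, 0), (6, 2, 5), (2, 0, 1), (0, 8, 5), (8, 2, 3), (2, 7, 4), (7, 3, 0), (3, 6, 1),
      (6, 8, 7), (8, 1, 4), (1, 5, 7), (5, 4, 3)]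
    (by decide) rfl (by decide) rfl rfl (by decide +kernel)

theorem hasAlternatingMinimumCovering_ten : HasAlternatingMinimumCovering 10 :=
  hasAlternatingMinimumCovering_of_list
    [(4, 1, 8), (1, 0, 2), (0, 2, 9), (2, 6, 5), (6, 9, 5), (9, 7, 8), (7, 2, 4), (2, 3, 8),
      (3, 9, 4), (9, 0, 1), (0, 8, 5), (8, 6, 7), (6, 0, 4), (0, 3, 7), (3, 1, 6), (1, 5, 7),
      (5, 4, 3)]
    (by decide) rfl (by decide) rfl rfl (by decide +kernel)

theorem hasAlternatingMinimumCovering_eleven : HasAlternatingMinimumCovering 11 :=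
  hasAlternatingMinimumCovering_of_list
    [(3, 8, 10), (8, 2, 6), (2, 0, 1), (0, 1, 10), (1, 9, 0), (9, 7, 8), (7, 2, 4),
      (2, 10, 9), (10, 5, 4), (5, 6, 9), (6, 1, 3), (1, 5, 7), (5, 3, 2), (3, 4, 9),
      (4, 8, 1), (8, 0, 5), (0, 6, 4), (6, 7, 10), (7, 3, 0)]
    (by decide) rfl (by decide) rfl rfl (by decide +kernel)

theorem hasAlternatingMinimumCovering_twelve : HasAlternatingMinimumCovering 12 :=
  hasAlternatingMinimumCovering_of_list
    [(3, 2, 5), (2, 0, 1), (0, 11, 10), (11, 9, 2), (9, 0, 1), (0, 8, 5), (8, 11, 7),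
      (11, 4, 3), (4, 5, 10), (5, 6, 11), (6, 2, 8), (2, 7, 4), (7, 5, 1), (5, 9, 6),
      (9, 10, 2), (10, 1, 11), (1, 4, 8), (4, 6, 0), (6, 3, 1), (3, 9, 4), (9, 8, 7),
      (8, 10, 3), (10, 7, 6), (7, 3, 0)]
    (by decide) rfl (by decide) rfl rfl (by decide +kernel)

theorem hasAlternatingMinimumCovering_thirteen : HasAlternatingMinimumCovering 13 :=
  hasAlternatingMinimumCovering_of_list
    [(2, 7, 0), (7, 1, 9), (1, 4, 0), (4, 10, 12), (10, 8, 2), (8, 1, 3), (1, 6, 12),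
      (6, 0, 8), (0, 11, 5), (11, 3, 9), (3, 10, 5), (10, 11, 1), (11, 2, 12), (2, 6, 3),
      (6, 4, 11), (4, 9, 2), (9, 10, 0), (10, 7, 6), (7, 5, 12), (5, 9, 6), (9, 12, 8),
      (12, 3, 0), (3, 7, 4), (7, 8, 11), (8, 5, 4), (5, 2, 1)]
    (by decide) rfl (by decide) rfl rfl (by decide +kernel)

theorem hasAlternatingMinimumCovering_fourteen : HasAlternatingMinimumCovering 14 :=
  hasAlternatingMinimumCovering_of_list
    [(1, 0, 4), (0, 1, 13), (1, 7, 9), (7, 5, 12), (5, 13, 6), (13, 12, 11), (12, 6, 1),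
      (6, 8, 0), (8, 13, 7), (13, 9, 10), (9, 3, 11), (3, 8, 1), (8, 2, 10), (2, 13, 3),
      (13, 4, 0), (4, 10, 12), (10, 5, 3), (5, 4, 8), (4, 9, 2), (9, 10, 0), (10, 11, 1),
      (11, 6, 4), (6, 7, 10), (7, 11, 8), (11, 0, 5), (0, 3, 12), (3, 7, 4), (7, 2, 0),
      (2, 12, 11), (12, 9, 8), (9, 6, 5), (6, 2, 3), (2, 1, 5)]
    (by decide) rfl (by decide) rfl rfl (by decide +kernel)

/-! ### Choosing a pair from each triple -/

/-- A family of triples `{p i, q i, r i}`, two-colored. The pair `q i, r i` of each triple is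
distinguished. -/
structure TripleFamily (X ι : Type*) where
  p : ι → X
  q : ι → X
  r : ι → X
  col : ι → Bool
  hpq : ∀ i, p i ≠ q i
  hpr : ∀ i, p i ≠ r i
  hqr : ∀ i, q i ≠ r i

namespace TripleFamily

variable {X ι : Type*} (F : TripleFamily X ι)

/-- The distinguished pairs of color `c` form a connected graph on all points. -/
def Linked (c : Bool) : Prop :=
  ∀ S : X → Prop, (∀ i, F.col i = c → (S (F.q i) ↔ S (F.r i))) → ∀ x y, S x → S y

/-- The point `x` belongs to the triple with index `i`. -/
def Mem (i : ι) (x : X) : Prop := x = F.p i ∨ x = F.q i ∨ x = F.r i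

/-- Some triple contains both `x` and `y`. -/
def Covers (x y : X) : Prop := ∃ i, F.Mem i x ∧ F.Mem i y

variable {F}

theorem Covers.symm {x y : X} (h : F.Covers x y) : F.Covers y x := by
  obtain ⟨i, h1, h2⟩ := h
  exact ⟨i, h2, h1⟩

theorem Linked.exists_sum_eq_pair [Fintype ι] [DecidableEq X] {c : Bool} (h : F.Linked c)
    (x y : X) : ∃ J : ι → ZMod 2, (∀ i, F.col i ≠ c → J i = 0) ∧
      ∀ v, ∑ i, J i * incidence F.q F.r i v
        = (if x = v then 1 else 0) + (if y = v then 1 else 0) := by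
  classical
  -- `J` is the indicator modulo two of a path from `x` to `y`; adding one edge moves its end to
  -- `z`.
  have step : ∀ i, F.col i = c → ∀ y z, ((y = F.q i ∧ z = F.r i) ∨ (y = F.r i ∧ z = F.q i)) →
      (∃ J : ι → ZMod 2, (∀ i, F.col i ≠ c → J i = 0) ∧
      ∀ v, ∑ i, J i * incidence F.q F.r i v
        = (if x = v then 1 else 0) + (if y = v then 1 else 0)) →
      (∃ J : ι → ZMod 2, (∀ i, F.col i ≠ c → J i = 0) ∧
      ∀ v, ∑ i, J i * incidence F.q F.r i v
        = (if x = v then 1 else 0) + (if z = v then 1 else 0)) := by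
    rintro i hi y z hyz ⟨J, hJ, hs⟩
    refine ⟨fun k => J k + if k = i then 1 else 0, fun k hk => ?_, fun v => ?_⟩
    · have : k ≠ i := by rintro rfl; exact hk hi
      simp [hJ k hk, this]
    · simp only [add_mul, Finset.sum_add_distrib, hs v, ite_mul, one_mul, zero_mul,
        Finset.sum_ite_eq', Finset.mem_univ, if_true]
      have key : ∀ s t w : ZMod 2, s + t + (t + w) = s + w := by decide
      have key' : ∀ s t w : ZMod 2, s + t + (w + t) = s + w := by decide
      rcases hyz with ⟨rfl, rfl⟩ | ⟨rfl, rfl⟩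
      · exact key _ _ _
      · exact key' _ _ _
  refine h (fun y => ∃ J : ι → ZMod 2, (∀ i, F.col i ≠ c → J i = 0) ∧
      ∀ v, ∑ i, J i * incidence F.q F.r i v
        = (if x = v then 1 else 0) + (if y = v then 1 else 0))
    (fun i hi => ⟨step i hi _ _ (Or.inl ⟨rfl, rfl⟩), step i hi _ _ (Or.inr ⟨rfl, rfl⟩)⟩) x y
    ⟨0, by simp, fun v => by simp [CharTwo.add_self_eq_zero]⟩

/-- In a connected graph every even set of vertices is the set of odd vertices of a subgraph. -/
theorem Linked.exists_sum_eq [Fintype ι] [Fintype X] [DecidableEq X] [Nonempty X] {c : Bool}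
    (h : F.Linked c) (T : X → ZMod 2) (hT : ∑ x, T x = 0) :
    ∃ J : ι → ZMod 2, (∀ i, F.col i ≠ c → J i = 0) ∧
      ∀ v, ∑ i, J i * incidence F.q F.r i v = T v := by
  -- Add the paths from a base point to all points of `T`; the ends at the base point cancel because
  -- `T` has even size.
  choose J hJ hs using h.exists_sum_eq_pair (Classical.arbitrary X)
  refine ⟨fun i => ∑ y, T y * J y i, fun i hi => ?_, fun v => ?_⟩
  · exact Finset.sum_eq_zero fun y _ => by rw [hJ y i hi, mul_zero]
  · simp only [Finset.sum_mul]
    rw [Finset.sum_comm]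
    simp only [mul_assoc, ← Finset.mul_sum, hs, mul_add, Finset.sum_add_distrib]
    rw [← Finset.sum_mul, hT]
    simp

theorem sum_incidence_vertices [Fintype X] [DecidableEq X] (a b : ι → X) (i : ι) :
    ∑ x, incidence a b i x = 0 := by
  simp [incidence, Finset.sum_add_distrib, CharTwo.add_self_eq_zero]

/-- Color `true` provides connectedness and color `false` repairs parity, so the two requirements on
the chosen pairs do not interfere. -/
theorem exists_tour [Fintype ι] [Fintype X] [Nonempty X] (h : ∀ c, F.Linked c) :
    ∃ x z : ℕ → X, x (Fintype.card ι) = x 0 ∧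
      (∀ k < Fintype.card ι, x k ≠ x (k + 1) ∧ z k ≠ x k ∧ z k ≠ x (k + 1)) ∧
      ∀ i, ∃ k < Fintype.card ι, ∀ y, F.Mem i y → y = x k ∨ y = x (k + 1) ∨ y = z k := by
  classical
  let a : ι → X := fun i => if F.col i = true then F.q i else F.p i
  let b₀ : ι → X := fun i => if F.col i = true then F.r i else F.q i
  -- The prescribed set is that of the odd vertices of the initial choice `a`, `b₀`; its size is
  -- even by the handshake lemma.
  obtain ⟨J, hJ, hs⟩ := (h false).exists_sum_eq (fun v => ∑ i, incidence a b₀ i v) (by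
    rw [Finset.sum_comm]
    exact Finset.sum_eq_zero fun i _ => sum_incidence_vertices a b₀ i)
  let b : ι → X := fun i => if F.col i = true then F.r i else if J i = 0 then F.q i else F.r i
  let d : ι → X := fun i => if F.col i = true then F.p i else if J i = 0 then F.r i else F.q i
  -- Replacing the edge `pq` by `pr` adds `qr` modulo two.
  have hinc : ∀ i v, incidence a b i v = incidence a b₀ i v + J i * incidence F.q F.r i v := by
    intro i v
    by_cases hc : F.col i = true
    · simp [incidence, a, b, b₀, hc, hJ i (by simp [hc])]
    · by_cases h0 : J i = 0
      · simp [incidence, a, b, b₀, hc, h0]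
      · have h1 : J i = 1 := (by decide : ∀ s : ZMod 2, s ≠ 0 → s = 1) _ h0
        simp only [incidence, a, b, b₀, hc, h1, one_ne_zero, if_false, one_mul, Bool.false_eq_true]
        generalize (if F.q i = v then (1 : ZMod 2) else 0) = s
        generalize (if F.r i = v then (1 : ZMod 2) else 0) = t
        generalize (if F.p i = v then (1 : ZMod 2) else 0) = w
        revert s t w
        decide
  have heven : ∀ v, ∑ i, incidence a b i v = 0 := fun v => by
    simp only [hinc, Finset.sum_add_distrib, hs v, CharTwo.add_self_eq_zero]
  have hconn : ∀ S : X → Prop, (∀ i, S (a i) ↔ S (b i)) → ∀ x y, S x → S y := fun S hS =>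
    h true S fun i hi => by simpa [a, b, hi] using hS i
  obtain ⟨u, l, hw, hl, hall⟩ := exists_euler_tour heven hconn
  obtain ⟨x, hx0, hx1, hx⟩ := hw.exists_vertices
  have hlen : l.length = Fintype.card ι := by
    rw [← List.toFinset_card_of_nodup hl, (Finset.eq_univ_iff_forall (s := l.toFinset)).2 (by simpa using hall),
      Finset.card_univ]
  have hne : ∀ i, a i ≠ b i ∧ d i ≠ a i ∧ d i ≠ b i := by
    intro i
    have h1 := F.hpq i
    have h2 := F.hpr i
    have h3 := F.hqr i
    simp only [a, b, d]
    split_ifs <;> simp [h1, h2, h3, h1.symm, h2.symm, h3.symm]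
  have hmem : ∀ i y, F.Mem i y → y = a i ∨ y = b i ∨ y = d i := by
    intro i y
    simp only [a, b, d, Mem]
    split_ifs <;> tauto
  rw [hlen] at hx1
  refine ⟨x, fun k => if hk : k < l.length then d l[k] else u, by rw [hx0, hx1], ?_, ?_⟩
  · intro k hk
    rw [← hlen] at hk
    simp only [hk, dif_pos]
    obtain ⟨h1, h2, h3⟩ := hne l[k]
    rcases hx k hk with ⟨e1, e2⟩ | ⟨e1, e2⟩ <;> rw [e1, e2]
    · exact ⟨h1, h2, h3⟩
    · exact ⟨h1.symm, h3, h2⟩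
  · intro i
    obtain ⟨k, hk, rfl⟩ := List.mem_iff_getElem.1 (hall i)
    refine ⟨k, hlen ▸ hk, fun y hy => ?_⟩
    simp only [hk, dif_pos]
    have := hmem _ y hy
    rcases hx k hk with ⟨e1, e2⟩ | ⟨e1, e2⟩ <;> rw [e1, e2] <;> tauto

theorem hasAlternatingMinimumCovering [Fintype ι] [Fintype X] (n : ℕ) (hn : 4 ≤ n)
    (hX : Fintype.card X = n) (hι : Fintype.card ι = schoenheim n)
    (h : ∀ c, F.Linked c) (hcov : ∀ x y, x ≠ y → F.Covers x y) :
    HasAlternatingMinimumCovering n := by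
  have : Nonempty X := Fintype.card_pos_iff.1 (by omega)
  obtain ⟨x, z, hx, hne, hc⟩ := exists_tour h
  have e : X ≃ Fin n := Fintype.equivFinOfCardEq hX
  refine hasAlternatingMinimumCovering_of_tour (Fintype.card ι) hι ?_ (fun k => e (x k))
    (fun k => e (z k)) (by rw [hx]) (fun k hk => by simpa using hne k hk) ?_
  · rw [hι, schoenheim]
    have : 4 * 2 ≤ n * (n / 2) := Nat.mul_le_mul hn (by omega)
    omega
  · intro a b hab
    obtain ⟨i, h1, h2⟩ := hcov (e.symm a) (e.symm b) (by simpa using hab)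
    obtain ⟨k, hk, hm⟩ := hc i
    have h1' := hm _ h1
    have h2' := hm _ h2
    simp only [Equiv.symm_apply_eq] at h1' h2'
    exact ⟨k, hk, h1', h2'⟩

/-! ### Images and unions of families -/

section Combine

variable {X Y ι γ : Type*}

/-- The image of a family of triples under an injection. -/
def map (F : TripleFamily X ι) (φ : X → Y) (hφ : Function.Injective φ) : TripleFamily Y ι where
  p := φ ∘ F.p
  q := φ ∘ F.q
  r := φ ∘ F.r
  col := F.col
  hpq i := hφ.ne (F.hpq i)
  hpr i := hφ.ne (F.hpr i)
  hqr i := hφ.ne (F.hqr i)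

/-- The union of two families of triples on the same points. -/
def sum (F : TripleFamily X ι) (G : TripleFamily X γ) : TripleFamily X (ι ⊕ γ) where
  p := Sum.elim F.p G.p
  q := Sum.elim F.q G.q
  r := Sum.elim F.r G.r
  col := Sum.elim F.col G.col
  hpq := Sum.rec F.hpq G.hpq
  hpr := Sum.rec F.hpr G.hpr
  hqr := Sum.rec F.hqr G.hqr

theorem Covers.map {F : TripleFamily X ι} {x y : X} (h : F.Covers x y) (φ : X → Y)
    (hφ : Function.Injective φ) : (F.map φ hφ).Covers (φ x) (φ y) := by
  obtain ⟨i, h1, h2⟩ := h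
  refine ⟨i, ?_, ?_⟩
  · rcases h1 with h | h | h <;> rw [h] <;> simp [Mem, TripleFamily.map]
  · rcases h2 with h | h | h <;> rw [h] <;> simp [Mem, TripleFamily.map]

theorem Covers.sum_left {F : TripleFamily X ι} {x y : X} (h : F.Covers x y)
    (G : TripleFamily X γ) : (F.sum G).Covers x y := by
  obtain ⟨i, h1, h2⟩ := h
  exact ⟨Sum.inl i, h1, h2⟩

theorem Covers.sum_right {G : TripleFamily X γ} {x y : X} (h : G.Covers x y)
    (F : TripleFamily X ι) : (F.sum G).Covers x y := by
  obtain ⟨i, h1, h2⟩ := h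
  exact ⟨Sum.inr i, h1, h2⟩

/-- A point outside the image of `φ` only has to hang on the image by one distinguished pair of
color `c`; further triples of `G` do no harm. -/
theorem Linked.map_sum {F : TripleFamily X ι} {c : Bool} (h : F.Linked c) (φ : X → Y)
    (hφ : Function.Injective φ) (G : TripleFamily Y γ)
    (hG : ∀ y, (∃ x, y = φ x) ∨ ∃ e, G.col e = c ∧ G.q e = y ∧ ∃ x, G.r e = φ x) :
    ((F.map φ hφ).sum G).Linked c := by
  intro S hS
  have hφS := h (fun x => S (φ x)) fun i hi => hS (Sum.inl i) hi
  have hrep : ∀ y, ∃ x, S y ↔ S (φ x) := by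
    intro y
    rcases hG y with ⟨x, rfl⟩ | ⟨e, he, rfl, x, hx⟩
    · exact ⟨x, Iff.rfl⟩
    · exact ⟨x, hx ▸ hS (Sum.inr e) he⟩
  intro y y' hy
  obtain ⟨x, hx⟩ := hrep y
  obtain ⟨x', hx'⟩ := hrep y'
  exact hx'.2 (hφS x x' (hx.1 hy))

end Combine

/-! ### Filling a hole -/

section Fill

variable {X ι γ : Type*} [Fintype X] [Fintype ι] [Fintype γ] {F : TripleFamily X ι}

/-- Since `F` is already linked on all points, the coloring of the filling `T` is irrelevant; only
its coverage and its size count. -/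
theorem hasAlternatingMinimumCovering_of_hole {h : ℕ} (hF : ∀ c, F.Linked c) (η : Fin h → X)
    (hη : Function.Injective η)
    (hcov : ∀ x y, x ≠ y → (x ∈ Set.range η ∧ y ∈ Set.range η) ∨ F.Covers x y)
    (T : TripleFamily (Fin h) γ) (hT : ∀ i j, i ≠ j → T.Covers i j) (n : ℕ) (hn : 4 ≤ n)
    (hX : Fintype.card X = n) (hι : Fintype.card ι + Fintype.card γ = schoenheim n) :
    HasAlternatingMinimumCovering n := by
  refine hasAlternatingMinimumCovering (F := (F.map id Function.injective_id).sum (T.map η hη))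
    n hn hX (by rw [Fintype.card_sum, hι])
    (fun c => (hF c).map_sum _ _ _ fun y => Or.inl ⟨y, rfl⟩) ?_
  intro x y hxy
  rcases hcov x y hxy with ⟨⟨i, rfl⟩, ⟨j, rfl⟩⟩ | h
  · exact ((hT i j fun h => hxy (h ▸ rfl)).map η hη).sum_right _
  · exact (h.map id Function.injective_id).sum_left _

/-- The triples joining a new point to the pairs of points outside a hole, together with triples
on the hole and the new point. -/
def fillPairs {h u : ℕ} (η : Fin h → X) (hη : Function.Injective η)
    (e : Fin u × Bool ≃ {x // x ∉ Set.range η}) (T : TripleFamily (Option (Fin h)) γ) :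
    TripleFamily (Option X) (γ ⊕ Fin u) :=
  (T.map (Option.map η) (Option.map_injective hη)).sum
    { p := fun i => some (e (i, false))
      q := fun _ => none
      r := fun i => some (e (i, true))
      col := fun i => decide (i.val = 0)
      hpq := fun i => by simp
      hpr := fun i h => by simpa using e.injective (Subtype.ext (Option.some.inj h))
      hqr := fun i => by simp }

theorem hasAlternatingMinimumCovering_succ_of_hole {h : ℕ} (hF : ∀ c, F.Linked c) (η : Fin h → X)
    (hη : Function.Injective η)
    (hcov : ∀ x y, x ≠ y → (x ∈ Set.range η ∧ y ∈ Set.range η) ∨ F.Covers x y)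
    (T : TripleFamily (Option (Fin h)) γ) (hT : ∀ i j, i ≠ j → T.Covers i j) (n u : ℕ)
    (hn : 4 ≤ n) (hu : 2 ≤ u) (hX : Fintype.card X + 1 = n) (hX' : Fintype.card X = h + 2 * u)
    (hι : Fintype.card ι + (Fintype.card γ + u) = schoenheim n) :
    HasAlternatingMinimumCovering n := by
  classical
  have hcard : Fintype.card (Fin u × Bool) = Fintype.card {x // x ∉ Set.range η} := by
    rw [Fintype.card_subtype_compl, Fintype.card_prod, Fintype.card_bool, Fintype.card_fin, hX']
    have : Fintype.card {x // x ∈ Set.range η} = h := by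
      exact (Fintype.card_congr (Equiv.ofInjective η hη)).symm.trans (Fintype.card_fin h)
    rw [this]
    omega
  let e := Fintype.equivOfCardEq hcard
  refine hasAlternatingMinimumCovering
    (F := (F.map some (Option.some_injective X)).sum (fillPairs η hη e T))
    n hn (by rw [Fintype.card_option, hX]) (by simp [hι])
    (fun c => (hF c).map_sum _ _ _ fun y => ?_) ?_
  · cases y with
    | some x => exact Or.inl ⟨x, rfl⟩
    | none =>
      -- Pair number 0 attaches the new point in color `true`, pair number 1 in color `false`; hence
      -- `2 ≤ u`.
      refine Or.inr ⟨Sum.inr (if c then ⟨0, by omega⟩ else ⟨1, by omega⟩), ?_, rfl, _, rfl⟩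
      cases c <;> simp [fillPairs, TripleFamily.sum]
  · have hnone : ∀ y : X, ((F.map some (Option.some_injective X)).sum
        (fillPairs η hη e T)).Covers none (some y) := by
      intro y
      refine Covers.sum_right ?_ _
      by_cases hy : y ∈ Set.range η
      · obtain ⟨j, rfl⟩ := hy
        exact ((hT none (some j) (by simp)).map (Option.map η) (Option.map_injective hη)).sum_left _
      · obtain ⟨⟨i, s⟩, hi⟩ := e.surjective ⟨y, hy⟩
        have hy' : y = (e (i, s) : X) := by rw [hi]
        refine ⟨Sum.inr i, Or.inr (Or.inl rfl), ?_⟩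
        cases s
        · exact Or.inl (congrArg some hy')
        · exact Or.inr (Or.inr (congrArg some hy'))
    intro x y hxy
    cases x with
    | none =>
      cases y with
      | none => exact absurd rfl hxy
      | some y => exact hnone y
    | some x =>
      cases y with
      | none => exact (hnone x).symm
      | some y =>
        rcases hcov x y (fun h => hxy (h ▸ rfl)) with ⟨⟨i, rfl⟩, ⟨j, rfl⟩⟩ | h
        · exact (((hT (some i) (some j) fun h => hxy (by rw [Option.some.inj h])).map (Option.map η)
            (Option.map_injective hη)).sum_left _).sum_right _
        · exact (h.map some (Option.some_injective X)).sum_left _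

end Fill

/-! ### Coverings of at most six points -/

instance decidableCovers {X ι : Type*} [DecidableEq X] [Fintype ι] (F : TripleFamily X ι) (x y : X) :
    Decidable (F.Covers x y) := by
  unfold Covers Mem
  infer_instance

/-- One triple on three points. -/
def fillThree : TripleFamily (Fin 3) (Fin 1) where
  p := ![0]
  q := ![1]
  r := ![2]
  col := ![true]
  hpq := by decide
  hpr := by decide
  hqr := by decide

/-- A minimum covering of four points. -/
def fillFour : TripleFamily (Option (Fin 3)) (Fin 3) where
  p := ![none, none, none]
  q := ![some 0, some 0, some 1]
  r := ![some 1, some 2, some 2]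
  col := ![true, true, true]
  hpq := by decide
  hpr := by decide
  hqr := by decide

/-- A minimum covering of five points. -/
def fillFive : TripleFamily (Fin 5) (Fin 4) where
  p := ![0, 0, 0, 2]
  q := ![1, 1, 1, 3]
  r := ![2, 3, 4, 4]
  col := ![true, true, true, true]
  hpq := by decide
  hpr := by decide
  hqr := by decide

/-- A minimum covering of six points. -/
def fillSix : TripleFamily (Option (Fin 5)) (Fin 6) where
  p := ![some 0, some 0, some 0, some 1, some 2, some 2]
  q := ![some 1, some 1, some 4, some 4, some 3, some 3]
  r := ![some 2, some 3, none, none, some 4, none]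
  col := ![true, true, true, true, true, true]
  hpq := by decide
  hpr := by decide
  hqr := by decide

theorem fillThree_covers : ∀ i j, i ≠ j → fillThree.Covers i j := by decide

theorem fillFour_covers : ∀ i j, i ≠ j → fillFour.Covers i j := by decide

theorem fillFive_covers : ∀ i j, i ≠ j → fillFive.Covers i j := by decide

theorem fillSix_covers : ∀ i j, i ≠ j → fillSix.Covers i j := by decide

/-! ### Three levels -/

/-- The index set of the triples `{(a, j), (b, j), (f j a b, j + 1)}`, `a < b`. -/
abbrev LevelIndex (k : ℕ) : Type := (Σ b : Fin k, Fin b.val) × Fin 3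

theorem card_levelIndex (k : ℕ) : Fintype.card (LevelIndex k) = k * (k - 1) / 2 * 3 := by
  rw [Fintype.card_prod, Fintype.card_sigma, Fintype.card_fin]
  simp only [Fintype.card_fin]
  rw [Fin.sum_univ_eq_sum_range (fun i => i) k, Finset.sum_range_id]

section Level

variable {k : ℕ}

/-- The smaller element of the pair given by an index. -/
def LevelIndex.fst (i : LevelIndex k) : Fin k := ⟨i.1.2, i.1.2.isLt.trans i.1.1.isLt⟩

theorem LevelIndex.fst_lt (i : LevelIndex k) : i.fst.val < i.1.1.val := i.1.2.isLt

theorem add_one_ne_self (j : Fin 3) : j + 1 ≠ j := by revert j; decide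

/-- The triples `{(a, j), (b, j), (f j a b, j + 1)}`, `a < b`. For most of them the distinguished pair
is `(a, j), (b, j)`, for those with `b = 4` and `a = 1, 2` it links two levels. -/
def levels (f : Fin 3 → Fin k → Fin k → Fin k) : TripleFamily (Fin k × Fin 3) (LevelIndex k) where
  p i := if i.1.1.val = 4 ∧ (i.fst.val = 1 ∨ i.fst.val = 2) then (i.1.1, i.2)
    else (f i.2 i.fst i.1.1, i.2 + 1)
  q i := (i.fst, i.2)
  r i := if i.1.1.val = 4 ∧ (i.fst.val = 1 ∨ i.fst.val = 2) then (f i.2 i.fst i.1.1, i.2 + 1)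
    else (i.1.1, i.2)
  col i := decide ((i.fst.val = 0 ∧ i.1.1.val ≠ 3) ∨ (i.fst.val = 1 ∧ i.1.1.val = 3) ∨
    (i.fst.val = 2 ∧ i.1.1.val = 4))
  hpq i := by
    have := i.fst_lt
    split_ifs
    · exact fun h => by have := congrArg (fun x => x.1.val) h; simp at this; omega
    · exact fun h => add_one_ne_self _ (congrArg Prod.snd h)
  hpr i := by
    split_ifs
    · exact fun h => add_one_ne_self _ (congrArg Prod.snd h).symm
    · exact fun h => add_one_ne_self _ (congrArg Prod.snd h)
  hqr i := by
    have := i.fst_lt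
    split_ifs
    · exact fun h => add_one_ne_self _ (congrArg Prod.snd h).symm
    · exact fun h => by have := congrArg (fun x => x.1.val) h; simp at this; omega

variable {f : Fin 3 → Fin k → Fin k → Fin k}

theorem levels_mem (i : LevelIndex k) : (levels f).Mem i (i.fst, i.2) ∧
    (levels f).Mem i (i.1.1, i.2) ∧ (levels f).Mem i (f i.2 i.fst i.1.1, i.2 + 1) := by
  simp only [Mem, levels]
  split_ifs <;> simp

theorem levels_covers_level (j : Fin 3) {a b : Fin k} (hab : a ≠ b) :
    (levels f).Covers (a, j) (b, j) := by
  rcases lt_or_gt_of_ne hab with h | h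
  · obtain ⟨h1, h2, -⟩ := levels_mem (f := f) (⟨b, ⟨a, h⟩⟩, j)
    exact ⟨_, h1, h2⟩
  · obtain ⟨h1, h2, -⟩ := levels_mem (f := f) (⟨a, ⟨b, h⟩⟩, j)
    exact ⟨_, h2, h1⟩

theorem levels_covers_cross (hf : ∀ j a b, f j a b = f j b a) (j : Fin 3) {a b : Fin k}
    (hab : a ≠ b) : (levels f).Covers (a, j) (f j a b, j + 1) := by
  rcases lt_or_gt_of_ne hab with h | h
  · obtain ⟨h1, -, h2⟩ := levels_mem (f := f) (⟨b, ⟨a, h⟩⟩, j)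
    exact ⟨_, h1, h2⟩
  · obtain ⟨-, h1, h2⟩ := levels_mem (f := f) (⟨a, ⟨b, h⟩⟩, j)
    rw [hf]
    exact ⟨_, h1, h2⟩

/-- On one level, color `true` contains a star at `0` that misses only `3`, which hangs on `1`;
color `false` contains a star at `3` that misses only `1`, which hangs on `2`. The pairs from `a =
2`, `b = 4` and from `a = 1`, `b = 4` are not needed for this and are spent on linking level `j` to
level `j + 1`, one in each color. -/
theorem levels_linked (hk : 5 ≤ k) (c : Bool) : (levels f).Linked c := by
  intro S hS
  have hedge : ∀ (a b : Fin k) (h : a.val < b.val) (j : Fin 3),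
      decide ((a.val = 0 ∧ b.val ≠ 3) ∨ (a.val = 1 ∧ b.val = 3) ∨ (a.val = 2 ∧ b.val = 4)) = c →
      (S (a, j) ↔ S (if b.val = 4 ∧ (a.val = 1 ∨ a.val = 2) then (f j a b, j + 1) else (b, j))) :=
    fun a b h j hc => hS (⟨b, ⟨a, h⟩⟩, j) hc
  have hlevel : ∃ a₀ : Fin k, ∀ j a, S (a, j) ↔ S (a₀, j) := by
    cases c with
    | true =>
      refine ⟨⟨0, by omega⟩, fun j => ?_⟩
      have hstar : ∀ b : Fin k, b.val ≠ 3 → (S (b, j) ↔ S (⟨0, by omega⟩, j)) := by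
        intro b hb
        by_cases hb0 : b.val = 0
        · rw [show b = ⟨0, by omega⟩ from Fin.ext hb0]
        · have := hedge ⟨0, by omega⟩ b (Nat.pos_of_ne_zero hb0) j (by simp [hb])
          simpa using this.symm
      intro b
      by_cases hb : b.val = 3
      · have := hedge ⟨1, by omega⟩ b (by simp [hb]) j (by simp [hb])
        simp only [hb, false_and, if_false, show ¬(3 = 4) by decide] at this
        rw [← this]
        exact hstar _ (by simp)
      · exact hstar b hb
    | false =>
      refine ⟨⟨3, by omega⟩, fun j => ?_⟩
      have hstar : ∀ b : Fin k, b.val ≠ 1 → (S (b, j) ↔ S (⟨3, by omega⟩, j)) := by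
        intro b hb
        rcases lt_trichotomy b.val 3 with h | h | h
        · have := hedge b ⟨3, by omega⟩ h j (by simp [hb])
          simpa using this
        · rw [show b = ⟨3, by omega⟩ from Fin.ext h]
        · have := hedge ⟨3, by omega⟩ b h j (by simp)
          simpa using this.symm
      intro b
      by_cases hb : b.val = 1
      · have := hedge b ⟨2, by omega⟩ (by simp [hb]) j (by simp [hb])
        simp only [show ¬(2 = 4) by decide, false_and, if_false] at this
        rw [this]
        exact hstar _ (by simp)
      · exact hstar b hb
  obtain ⟨a₀, ha₀⟩ := hlevel
  have hup : ∀ j, S (a₀, j) ↔ S (a₀, j + 1) := by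
    intro j
    have h4 : 4 < k := hk
    cases c with
    | true =>
      have := hedge ⟨2, by omega⟩ ⟨4, h4⟩ (by simp) j (by simp)
      simp only [true_and, or_true, if_true] at this
      rw [← ha₀ j, this, ha₀]
    | false =>
      have := hedge ⟨1, by omega⟩ ⟨4, h4⟩ (by simp) j (by simp)
      simp only [true_and, true_or, if_true] at this
      rw [← ha₀ j, this, ha₀]
  have hbase : ∀ j, S (a₀, j) ↔ S (a₀, 0) := by
    have h0 := hup 0
    have h1 := hup 1
    have e1 : (0 : Fin 3) + 1 = 1 := rfl
    have e2 : (1 : Fin 3) + 1 = 2 := rfl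
    rw [e1] at h0
    rw [e2] at h1
    intro j
    fin_cases j
    · exact Iff.rfl
    · exact h0.symm
    · exact h1.symm.trans h0.symm
  rintro ⟨a, i⟩ ⟨b, j⟩ h
  rw [ha₀, hbase] at h ⊢
  exact h

/-- Any two different levels modulo three are consecutive in one order or the other. -/
theorem forall_pairs_of_levels {R : Fin k × Fin 3 → Fin k × Fin 3 → Prop}
    (hsymm : ∀ x y, R x y → R y x) (hlevel : ∀ j a b, a ≠ b → R (a, j) (b, j))
    (hcross : ∀ j a c, R (a, j) (c, j + 1)) : ∀ x y, x ≠ y → R x y := by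
  rintro ⟨a, i⟩ ⟨b, j⟩ hne
  have : j = i ∨ j = i + 1 ∨ i = j + 1 := by
    clear hne
    revert i j
    decide
  rcases this with rfl | rfl | rfl
  · exact hlevel j a b fun h => hne (h ▸ rfl)
  · exact hcross i a b
  · exact hsymm _ _ (hcross j b a)

end Level

end TripleFamily

theorem schoenheim_eq {n m : ℕ} (h1 : n * (n / 2) ≤ 3 * m) (h2 : 3 * m ≤ n * (n / 2) + 2) :
    schoenheim n = m := by
  unfold schoenheim
  omega

namespace TripleFamily

/-! ### Constructions over the integers modulo `2 * t + 1` -/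

section Odd

variable {t : ℕ}

/-- The mean of two elements of the integers modulo `2 * t + 1`. -/
def mean (a b : Fin (2 * t + 1)) : Fin (2 * t + 1) :=
  ⟨if (a.val + b.val) % 2 = 0 then (a.val + b.val) / 2
    else if a.val + b.val < 2 * t + 1 then (a.val + b.val + (2 * t + 1)) / 2
    else (a.val + b.val - (2 * t + 1)) / 2, by split_ifs <;> omega⟩

theorem mean_comm (a b : Fin (2 * t + 1)) : mean a b = mean b a := by
  simp only [mean, add_comm]

/-- Take `b = 2c - a`; as 2 is invertible modulo `2 * t + 1`, `b = a` would force `c = a`. -/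
theorem exists_mean_eq {a c : Fin (2 * t + 1)} (h : c ≠ a) : ∃ b, a ≠ b ∧ mean a b = c := by
  have h' : c.val ≠ a.val := fun e => h (Fin.ext e)
  have ha := a.isLt
  have hc := c.isLt
  refine ⟨⟨if a.val ≤ 2 * c.val then
    (if 2 * c.val - a.val < 2 * t + 1 then 2 * c.val - a.val else 2 * c.val - a.val - (2 * t + 1))
    else 2 * c.val + (2 * t + 1) - a.val, by split_ifs <;> omega⟩, ?_, ?_⟩
  · intro e
    have e := congrArg Fin.val e
    simp only at e
    split_ifs at e <;> omega
  · apply Fin.ext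
    simp only [mean]
    split_ifs <;> omega

/-- The opposite of an element of the integers modulo `2 * t + 1`. -/
def opp (a : Fin (2 * t + 1)) : Fin (2 * t + 1) :=
  ⟨if a.val = 0 then 0 else 2 * t + 1 - a.val, by split_ifs <;> omega⟩

theorem opp_opp (a : Fin (2 * t + 1)) : opp (opp a) = a := by
  apply Fin.ext
  have := a.isLt
  simp only [opp]
  split_ifs <;> omega

theorem opp_zero : opp (0 : Fin (2 * t + 1)) = 0 := by
  apply Fin.ext
  simp [opp]

theorem card_levelIndex_odd : Fintype.card (LevelIndex (2 * t + 1)) = (2 * t + 1) * t * 3 := by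
  have : (2 * t + 1) * (2 * t) = (2 * t + 1) * t * 2 := by ring
  rw [card_levelIndex, Nat.add_sub_cancel, this, Nat.mul_div_cancel _ two_pos]

/-! ### Points `≡ 3 (mod 6)` -/

/-- The triples `{(a, 0), (a, 1), (a, 2)}` with `a ≠ 0`. -/
def verticals : TripleFamily (Fin (2 * t + 1) × Fin 3) (Fin (2 * t)) where
  p a := (a.succ, 0)
  q a := (a.succ, 1)
  r a := (a.succ, 2)
  col _ := true
  hpq _ h := by simpa using congrArg Prod.snd h
  hpr _ h := by simpa using congrArg Prod.snd h
  hqr _ h := by simpa using congrArg Prod.snd h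

theorem verticals_covers {a : Fin (2 * t + 1)} (ha : a ≠ 0) (i j : Fin 3) :
    verticals.Covers (a, i) (a, j) := by
  have h : ∀ i, (verticals (t := t)).Mem (a.pred ha) (a, i) := by
    intro i
    simp only [Mem, verticals, Fin.succ_pred]
    fin_cases i <;> simp
  exact ⟨a.pred ha, h i, h j⟩

/-- The Bose construction of a Steiner triple system, without one of its triples. -/
def boseFamily (t : ℕ) : TripleFamily (Fin (2 * t + 1) × Fin 3)
    (LevelIndex (2 * t + 1) ⊕ Fin (2 * t)) :=
  ((levels fun _ => mean).map id Function.injective_id).sum verticals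

theorem boseFamily_linked (ht : 2 ≤ t) (c : Bool) : (boseFamily t).Linked c :=
  (levels_linked (by omega) c).map_sum _ _ _ fun y => Or.inl ⟨y, rfl⟩

/-- The points `(a, 0), (a, 1), (a, 2)`. -/
def column {k : ℕ} (a : Fin k) (j : Fin 3) : Fin k × Fin 3 := (a, j)

theorem column_injective {k : ℕ} (a : Fin k) : Function.Injective (column a) :=
  fun _ _ h => congrArg Prod.snd h

theorem boseFamily_covers : ∀ x y : Fin (2 * t + 1) × Fin 3, x ≠ y →
    (x ∈ Set.range (column 0) ∧ y ∈ Set.range (column 0)) ∨ (boseFamily t).Covers x y := by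
  refine forall_pairs_of_levels (fun x y h => h.imp And.symm Covers.symm) ?_ ?_
  · intro j a b hab
    exact Or.inr (((levels_covers_level j hab).map id Function.injective_id).sum_left _)
  · intro j a c
    by_cases hca : c = a
    · subst hca
      by_cases hc : c = 0
      · subst hc
        exact Or.inl ⟨⟨_, rfl⟩, ⟨_, rfl⟩⟩
      · exact Or.inr ((verticals_covers hc j (j + 1)).sum_right _)
    · obtain ⟨b, hb, rfl⟩ := exists_mean_eq hca
      exact Or.inr (((levels_covers_cross (fun _ => mean_comm) j hb).map id
        Function.injective_id).sum_left _)

theorem card_boseIndex :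
    Fintype.card (LevelIndex (2 * t + 1) ⊕ Fin (2 * t)) = (2 * t + 1) * t * 3 + 2 * t := by
  rw [Fintype.card_sum, card_levelIndex_odd, Fintype.card_fin]

theorem hasAlternatingMinimumCovering_three_mod_six (ht : 2 ≤ t) :
    HasAlternatingMinimumCovering (6 * t + 3) := by
  refine hasAlternatingMinimumCovering_of_hole (boseFamily_linked ht) (column 0)
    (column_injective 0) boseFamily_covers fillThree fillThree_covers _ (by omega) ?_ ?_
  · simp only [Fintype.card_prod, Fintype.card_fin]
    ring
  · rw [card_boseIndex, Fintype.card_fin]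
    symm
    apply schoenheim_eq <;> rw [show (6 * t + 3) / 2 = 3 * t + 1 by omega] <;> nlinarith

theorem hasAlternatingMinimumCovering_four_mod_six (ht : 2 ≤ t) :
    HasAlternatingMinimumCovering (6 * t + 4) := by
  refine hasAlternatingMinimumCovering_succ_of_hole (boseFamily_linked ht) (column 0)
    (column_injective 0) boseFamily_covers fillFour fillFour_covers _ (3 * t) (by omega) (by omega)
    ?_ ?_ ?_
  · simp only [Fintype.card_prod, Fintype.card_fin]
    ring
  · simp only [Fintype.card_prod, Fintype.card_fin]
    ring
  · rw [card_boseIndex, Fintype.card_fin]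
    symm
    apply schoenheim_eq <;> rw [show (6 * t + 4) / 2 = 3 * t + 2 by omega] <;> nlinarith

/-! ### Points `≡ 5 (mod 6)` -/

/-- The mean, with opposite sign on the last level. -/
def twistedMean (j : Fin 3) (a b : Fin (2 * t + 1)) : Fin (2 * t + 1) :=
  if j = 2 then opp (mean a b) else mean a b

/-- The opposite on the last level, the identity on the others. -/
def twist (j : Fin 3) (a : Fin (2 * t + 1)) : Fin (2 * t + 1) := if j = 2 then opp a else a

theorem twist_zero (j : Fin 3) : twist j (0 : Fin (2 * t + 1)) = 0 := by
  unfold twist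
  split_ifs
  · exact opp_zero
  · rfl

theorem exists_twistedMean_eq (j : Fin 3) {a c : Fin (2 * t + 1)} (h : c ≠ twist j a) :
    ∃ b, a ≠ b ∧ twistedMean j a b = c := by
  unfold twist at h
  unfold twistedMean
  split_ifs at h ⊢ with hj
  · obtain ⟨b, hb, hb'⟩ := exists_mean_eq (a := a) (c := opp c) fun e => h (by rw [← e, opp_opp])
    exact ⟨b, hb, by rw [hb', opp_opp]⟩
  · exact exists_mean_eq h

/-- The new point that is joined to the pair `(a, j), (twist j a, j + 1)`. -/
def side (j : Fin 3) (a : Fin (2 * t + 1)) : Fin 2 := if j.val = 1 ↔ a.val ≤ t then 1 else 0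

/-- For `a ≠ 0` the pairs `(a, j), (twist j a, j + 1)` form the hexagon `(a,0), (a,1), (a,2),
(-a,0), (-a,1), (-a,2)`. Being an even cycle, it splits into two perfect matchings, one for each new
point, and `side` alternates along it. Without the twist the cycles would be triangles. -/
theorem side_or (a : Fin (2 * t + 1)) (ha : a ≠ 0) (j : Fin 3) (e : Fin 2) : side j a = e ∨
    ∃ (j' : Fin 3) (a' : Fin (2 * t + 1)), a' ≠ 0 ∧ j' + 1 = j ∧ twist j' a' = a ∧
      side j' a' = e := by
  have ha0 : a.val ≠ 0 := fun h => ha (Fin.ext h)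
  have hlt := a.isLt
  by_cases hat : a.val ≤ t
  · fin_cases j
    · fin_cases e
      · left
        simp [side, hat]
      · refine Or.inr ⟨2, opp a, fun h => ha (by rw [← opp_opp a, h, opp_zero]), rfl, ?_, ?_⟩
        · simp [twist, opp_opp]
        · simp only [side, opp, ha0, if_false]
          exact if_pos (iff_of_false (by decide) (by omega))
    · fin_cases e
      · exact Or.inr ⟨0, a, ha, rfl, by simp [twist], by simp [side, hat]⟩
      · left
        simp [side, hat]
    · fin_cases e
      · left
        simp [side, hat]
      · exact Or.inr ⟨1, a, ha, rfl, by simp [twist], by simp [side, hat]⟩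
  · fin_cases j
    · fin_cases e
      · refine Or.inr ⟨2, opp a, fun h => ha (by rw [← opp_opp a, h, opp_zero]), rfl, ?_, ?_⟩
        · simp [twist, opp_opp]
        · simp only [side, opp, ha0, if_false]
          exact if_neg fun h => absurd (h.2 (by omega)) (by decide)
      · left
        simp [side, hat]
    · fin_cases e
      · left
        simp [side, hat]
      · exact Or.inr ⟨0, a, ha, rfl, by simp [twist], by simp [side, hat]⟩
    · fin_cases e
      · exact Or.inr ⟨1, a, ha, rfl, by simp [twist], by simp [side, hat]⟩
      · left
        simp [side, hat]

/-- The triples joining two new points to the pairs `(a, j), (twist j a, j + 1)` with `a ≠ 0`. -/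
def twistTriples : TripleFamily ((Fin (2 * t + 1) × Fin 3) ⊕ Fin 2) (Fin (2 * t) × Fin 3) where
  p i := Sum.inl (twist i.2 i.1.succ, i.2 + 1)
  q i := Sum.inr (side i.2 i.1.succ)
  r i := Sum.inl (i.1.succ, i.2)
  col i := decide (i.2 = 0)
  hpq _ := Sum.inl_ne_inr
  hpr _ h := add_one_ne_self _ (congrArg Prod.snd (Sum.inl_injective h))
  hqr _ := Sum.inr_ne_inl

theorem twistTriples_mem {a : Fin (2 * t + 1)} (ha : a ≠ 0) (j : Fin 3) :
    twistTriples.Mem (a.pred ha, j) (Sum.inl (twist j a, j + 1)) ∧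
    twistTriples.Mem (a.pred ha, j) (Sum.inr (side j a)) ∧
    twistTriples.Mem (a.pred ha, j) (Sum.inl (a, j)) := by
  simp only [Mem, twistTriples, Fin.succ_pred]
  simp

/-- A pairwise balanced design with triples and one block of size five, which is left out. -/
def twistFamily (t : ℕ) : TripleFamily ((Fin (2 * t + 1) × Fin 3) ⊕ Fin 2)
    (LevelIndex (2 * t + 1) ⊕ (Fin (2 * t) × Fin 3)) :=
  ((levels twistedMean).map Sum.inl Sum.inl_injective).sum twistTriples

theorem twistFamily_linked (ht : 2 ≤ t) (c : Bool) : (twistFamily t).Linked c := by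
  refine (levels_linked (by omega) c).map_sum _ _ _ ?_
  rintro (y | e)
  · exact Or.inl ⟨y, rfl⟩
  · right
    -- The witnesses are the elements `1 ≤ t` and `2 * t > t`, which lie on different sides.
    obtain ⟨a, ha⟩ : ∃ a : Fin (2 * t), side 0 a.succ = e := by
      fin_cases e
      · exact ⟨⟨0, by omega⟩, by simp [side]; omega⟩
      · exact ⟨⟨2 * t - 1, by omega⟩, by simp [side]; omega⟩
    obtain ⟨a', ha'⟩ : ∃ a : Fin (2 * t), side 2 a.succ = e := by
      fin_cases e
      · exact ⟨⟨0, by omega⟩, by simp [side]; omega⟩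
      · exact ⟨⟨2 * t - 1, by omega⟩, by simp [side]; omega⟩
    cases c with
    | true => exact ⟨(a, 0), rfl, congrArg Sum.inr ha, _, rfl⟩
    | false => exact ⟨(a', 2), rfl, congrArg Sum.inr ha', _, rfl⟩

/-- The points of the block of size five. -/
def bigBlock (i : Fin 5) : (Fin (2 * t + 1) × Fin 3) ⊕ Fin 2 :=
  Sum.map (column 0) id ((finSumFinEquiv (m := 3) (n := 2)).symm i)

theorem bigBlock_injective : Function.Injective (bigBlock (t := t)) :=
  (Sum.map_injective.2 ⟨column_injective 0, Function.injective_id⟩).comp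
    (finSumFinEquiv (m := 3) (n := 2)).symm.injective

theorem inl_mem_range_bigBlock (j : Fin 3) :
    Sum.inl (0, j) ∈ Set.range (bigBlock (t := t)) :=
  ⟨(finSumFinEquiv (m := 3) (n := 2)) (Sum.inl j), by
    simp only [bigBlock, Equiv.symm_apply_apply]
    rfl⟩

theorem inr_mem_range_bigBlock (e : Fin 2) : Sum.inr e ∈ Set.range (bigBlock (t := t)) :=
  ⟨(finSumFinEquiv (m := 3) (n := 2)) (Sum.inr e), by
    simp only [bigBlock, Equiv.symm_apply_apply]
    rfl⟩

theorem twistFamily_covers : ∀ x y : (Fin (2 * t + 1) × Fin 3) ⊕ Fin 2, x ≠ y →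
    (x ∈ Set.range bigBlock ∧ y ∈ Set.range bigBlock) ∨ (twistFamily t).Covers x y := by
  have hinl : ∀ x y : Fin (2 * t + 1) × Fin 3, x ≠ y →
      (Sum.inl x ∈ Set.range bigBlock ∧ Sum.inl y ∈ Set.range bigBlock) ∨
        (twistFamily t).Covers (Sum.inl x) (Sum.inl y) := by
    refine forall_pairs_of_levels (fun x y h => h.imp And.symm Covers.symm) ?_ ?_
    · intro j a b hab
      exact Or.inr (((levels_covers_level j hab).map Sum.inl Sum.inl_injective).sum_left _)
    · intro j a c
      by_cases hca : c = twist j a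
      · subst hca
        by_cases ha : a = 0
        · subst ha
          rw [twist_zero]
          exact Or.inl ⟨inl_mem_range_bigBlock _, inl_mem_range_bigBlock _⟩
        · obtain ⟨h1, -, h2⟩ := twistTriples_mem ha j
          exact Or.inr (Covers.sum_right ⟨_, h2, h1⟩ _)
      · obtain ⟨b, hb, rfl⟩ := exists_twistedMean_eq j hca
        have hcomm : ∀ j (a b : Fin (2 * t + 1)), twistedMean j a b = twistedMean j b a :=
          fun j a b => by simp only [twistedMean, mean_comm]
        exact Or.inr (((levels_covers_cross hcomm j hb).map Sum.inl Sum.inl_injective).sum_left _)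
  have hmix : ∀ (x : Fin (2 * t + 1) × Fin 3) (e : Fin 2),
      (Sum.inl x ∈ Set.range bigBlock ∧ Sum.inr e ∈ Set.range (bigBlock (t := t))) ∨
        (twistFamily t).Covers (Sum.inl x) (Sum.inr e) := by
    rintro ⟨a, j⟩ e
    by_cases ha : a = 0
    · subst ha
      exact Or.inl ⟨inl_mem_range_bigBlock _, inr_mem_range_bigBlock _⟩
    · right
      refine Covers.sum_right ?_ _
      rcases side_or a ha j e with rfl | ⟨j', a', ha', rfl, rfl, rfl⟩
      · obtain ⟨-, h1, h2⟩ := twistTriples_mem ha j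
        exact ⟨_, h2, h1⟩
      · obtain ⟨h1, h2, -⟩ := twistTriples_mem ha' j'
        exact ⟨_, h1, h2⟩
  rintro (x | e) (y | e') hne
  · exact hinl x y fun h => hne (h ▸ rfl)
  · exact hmix x e'
  · exact (hmix y e).imp And.symm Covers.symm
  · exact Or.inl ⟨inr_mem_range_bigBlock _, inr_mem_range_bigBlock _⟩

theorem card_twistIndex : Fintype.card (LevelIndex (2 * t + 1) ⊕ (Fin (2 * t) × Fin 3))
    = (2 * t + 1) * t * 3 + 2 * t * 3 := by
  rw [Fintype.card_sum, card_levelIndex_odd, Fintype.card_prod, Fintype.card_fin, Fintype.card_fin]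

theorem hasAlternatingMinimumCovering_five_mod_six (ht : 2 ≤ t) :
    HasAlternatingMinimumCovering (6 * t + 5) := by
  refine hasAlternatingMinimumCovering_of_hole (twistFamily_linked ht) bigBlock
    bigBlock_injective twistFamily_covers fillFive fillFive_covers _ (by omega) ?_ ?_
  · simp only [Fintype.card_sum, Fintype.card_prod, Fintype.card_fin]
    ring
  · rw [card_twistIndex, Fintype.card_fin]
    symm
    apply schoenheim_eq <;> rw [show (6 * t + 5) / 2 = 3 * t + 2 by omega] <;> nlinarith

theorem hasAlternatingMinimumCovering_zero_mod_six (ht : 2 ≤ t) :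
    HasAlternatingMinimumCovering (6 * t + 6) := by
  refine hasAlternatingMinimumCovering_succ_of_hole (twistFamily_linked ht) bigBlock
    bigBlock_injective twistFamily_covers fillSix fillSix_covers _ (3 * t) (by omega) (by omega)
    ?_ ?_ ?_
  · simp only [Fintype.card_sum, Fintype.card_prod, Fintype.card_fin]
    ring
  · simp only [Fintype.card_sum, Fintype.card_prod, Fintype.card_fin]
    ring
  · rw [card_twistIndex, Fintype.card_fin]
    symm
    apply schoenheim_eq <;> rw [show (6 * t + 6) / 2 = 3 * t + 3 by omega] <;> nlinarith

end Odd

/-! ### Points `≡ 1 (mod 6)` -/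

section Even

variable {t : ℕ}

/-- A half-idempotent commutative quasigroup operation on `2 * t` elements. -/
def halfMean (a b : Fin (2 * t)) : Fin (2 * t) :=
  ⟨if a.val + b.val < 2 * t then
      (if (a.val + b.val) % 2 = 0 then (a.val + b.val) / 2 else t + (a.val + b.val) / 2)
    else (if (a.val + b.val) % 2 = 0 then (a.val + b.val - 2 * t) / 2
      else t + (a.val + b.val - 2 * t) / 2), by split_ifs <;> omega⟩

theorem halfMean_comm (a b : Fin (2 * t)) : halfMean a b = halfMean b a := by
  simp only [halfMean, add_comm]

/-- `halfMean` is addition modulo `2 * t` followed by a relabeling, and `s` is the sum labeled `c`.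
So `b = s - a`, and `b = a` needs `s` even, that is `c < t`, and then `a` is `c` or `c + t`. These
exceptions are what `lowVerticals` and `diagonals` cover, apart from the hole. -/
theorem exists_halfMean_eq {a c : Fin (2 * t)}
    (h : c.val < t → a.val ≠ c.val ∧ a.val ≠ c.val + t) : ∃ b, a ≠ b ∧ halfMean a b = c := by
  have ha := a.isLt
  have hc := c.isLt
  obtain ⟨s, hs⟩ : ∃ s, s = if c.val < t then 2 * c.val else 2 * (c.val - t) + 1 := ⟨_, rfl⟩
  have hs' : s < 2 * t := by split_ifs at hs <;> omega
  refine ⟨⟨if a.val ≤ s then s - a.val else s + 2 * t - a.val, by split_ifs <;> omega⟩, ?_, ?_⟩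
  · intro e
    have e := congrArg Fin.val e
    simp only at e
    split_ifs at e hs <;> omega
  · apply Fin.ext
    simp only [halfMean]
    split_ifs at hs <;> split_ifs <;> omega

/-- The triples `{(a, 0), (a, 1), (a, 2)}` with `0 < a < t`. -/
def lowVerticals (t : ℕ) : TripleFamily ((Fin (2 * t) × Fin 3) ⊕ Unit) (Fin (t - 1)) where
  p a := Sum.inl (⟨a.val + 1, by omega⟩, 0)
  q a := Sum.inl (⟨a.val + 1, by omega⟩, 1)
  r a := Sum.inl (⟨a.val + 1, by omega⟩, 2)
  col _ := true
  hpq _ h := by simpa using congrArg Prod.snd (Sum.inl_injective h)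
  hpr _ h := by simpa using congrArg Prod.snd (Sum.inl_injective h)
  hqr _ h := by simpa using congrArg Prod.snd (Sum.inl_injective h)

/-- The triples joining a new point to the pairs `(t + a, j), (a, j + 1)` with `a < t`. -/
def diagonals (t : ℕ) : TripleFamily ((Fin (2 * t) × Fin 3) ⊕ Unit) (Fin t × Fin 3) where
  p i := Sum.inl (⟨i.1.val, by omega⟩, i.2 + 1)
  q _ := Sum.inr ()
  r i := Sum.inl (⟨t + i.1.val, by omega⟩, i.2)
  col i := decide (i.1.val = 0)
  hpq _ := Sum.inl_ne_inr
  hpr _ h := add_one_ne_self _ (congrArg Prod.snd (Sum.inl_injective h))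
  hqr _ := Sum.inr_ne_inl

/-- The Skolem construction of a Steiner triple system, without one of its triples. -/
def skolemFamily (t : ℕ) : TripleFamily ((Fin (2 * t) × Fin 3) ⊕ Unit)
    (LevelIndex (2 * t) ⊕ (Fin (t - 1) ⊕ (Fin t × Fin 3))) :=
  ((levels fun _ => halfMean).map Sum.inl Sum.inl_injective).sum
    ((lowVerticals t).sum (diagonals t))

theorem skolemFamily_linked (ht : 3 ≤ t) (c : Bool) : (skolemFamily t).Linked c := by
  refine (levels_linked (by omega) c).map_sum _ _ _ ?_
  rintro (y | ⟨⟩)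
  · exact Or.inl ⟨y, rfl⟩
  · right
    cases c with
    | true => exact ⟨Sum.inr (⟨0, by omega⟩, 0), rfl, rfl, _, rfl⟩
    | false => exact ⟨Sum.inr (⟨1, by omega⟩, 0), rfl, rfl, _, rfl⟩

theorem skolemFamily_covers (ht : 0 < 2 * t) : ∀ x y : (Fin (2 * t) × Fin 3) ⊕ Unit, x ≠ y →
    (x ∈ Set.range (Sum.inl ∘ column ⟨0, ht⟩) ∧ y ∈ Set.range (Sum.inl ∘ column ⟨0, ht⟩)) ∨
      (skolemFamily t).Covers x y := by
  have hinl : ∀ x y : Fin (2 * t) × Fin 3, x ≠ y →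
      ((Sum.inl x : (Fin (2 * t) × Fin 3) ⊕ Unit) ∈ Set.range (Sum.inl ∘ column ⟨0, ht⟩) ∧
        (Sum.inl y : (Fin (2 * t) × Fin 3) ⊕ Unit) ∈ Set.range (Sum.inl ∘ column ⟨0, ht⟩)) ∨
        (skolemFamily t).Covers (Sum.inl x) (Sum.inl y) := by
    refine forall_pairs_of_levels (fun x y h => h.imp And.symm Covers.symm) ?_ ?_
    · intro j a b hab
      exact Or.inr (((levels_covers_level j hab).map Sum.inl Sum.inl_injective).sum_left _)
    · intro j a c
      by_cases hct : c.val < t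
      · by_cases hca : c = a
        · subst hca
          by_cases hc : c.val = 0
          · obtain rfl : c = ⟨0, ht⟩ := Fin.ext hc
            exact Or.inl ⟨⟨_, rfl⟩, ⟨_, rfl⟩⟩
          · right
            refine Covers.sum_right (Covers.sum_left ?_ _) _
            have h : ∀ i, (lowVerticals t).Mem ⟨c.val - 1, by omega⟩ (Sum.inl (c, i)) := by
              intro i
              have hc' : (⟨c.val - 1 + 1, by omega⟩ : Fin (2 * t)) = c :=
                Fin.ext (Nat.sub_add_cancel (Nat.pos_of_ne_zero hc))
              simp only [Mem, lowVerticals, hc']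
              fin_cases i <;> simp
            exact ⟨_, h j, h (j + 1)⟩
        · by_cases hca' : a.val = c.val + t
          · right
            refine Covers.sum_right (Covers.sum_right ?_ _) _
            refine ⟨(⟨c.val, hct⟩, j), Or.inr (Or.inr ?_), Or.inl rfl⟩
            have : a = ⟨t + c.val, by omega⟩ := Fin.ext (by simp only; omega)
            rw [this]
            rfl
          · obtain ⟨b, hb, rfl⟩ := exists_halfMean_eq (a := a) (c := c) fun _ =>
              ⟨fun h => hca (Fin.ext h.symm), hca'⟩
            exact Or.inr (((levels_covers_cross (fun _ => halfMean_comm) j hb).map Sum.inl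
              Sum.inl_injective).sum_left _)
      · obtain ⟨b, hb, rfl⟩ := exists_halfMean_eq (a := a) (c := c) fun h => absurd h hct
        exact Or.inr (((levels_covers_cross (fun _ => halfMean_comm) j hb).map Sum.inl
          Sum.inl_injective).sum_left _)
  have hmix : ∀ x : Fin (2 * t) × Fin 3, (skolemFamily t).Covers (Sum.inl x) (Sum.inr ()) := by
    rintro ⟨a, j⟩
    refine Covers.sum_right (Covers.sum_right ?_ _) _
    by_cases hat : a.val < t
    · obtain ⟨j', rfl⟩ : ∃ j', j' + 1 = j := ⟨j - 1, sub_add_cancel j 1⟩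
      exact ⟨(⟨a.val, hat⟩, j'), Or.inl rfl, Or.inr (Or.inl rfl)⟩
    · refine ⟨(⟨a.val - t, by omega⟩, j), Or.inr (Or.inr ?_), Or.inr (Or.inl rfl)⟩
      have : a = ⟨t + (a.val - t), by omega⟩ := Fin.ext (by simp only; omega)
      exact congrArg (fun b => Sum.inl (b, j)) this
  rintro (x | ⟨⟩) (y | ⟨⟩) hne
  · exact hinl x y fun h => hne (h ▸ rfl)
  · exact Or.inr (hmix x)
  · exact Or.inr (hmix y).symm
  · exact absurd rfl hne

/-- The added one stands for the triple on the hole and absorbs the truncated `t - 1`. -/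
theorem card_skolemIndex (ht : 0 < t) :
    Fintype.card (LevelIndex (2 * t) ⊕ (Fin (t - 1) ⊕ (Fin t × Fin 3))) + 1
      = t * (2 * t - 1) * 3 + 4 * t := by
  have : 2 * t * (2 * t - 1) = t * (2 * t - 1) * 2 := by ring
  rw [Fintype.card_sum, card_levelIndex, this, Nat.mul_div_cancel _ two_pos]
  simp only [Fintype.card_sum, Fintype.card_prod, Fintype.card_fin]
  omega

theorem hasAlternatingMinimumCovering_one_mod_six (ht : 3 ≤ t) :
    HasAlternatingMinimumCovering (6 * t + 1) := by
  refine hasAlternatingMinimumCovering_of_hole (skolemFamily_linked ht) _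
    (Sum.inl_injective.comp (column_injective _)) (skolemFamily_covers (by omega)) fillThree
    fillThree_covers _ (by omega) ?_ ?_
  · simp only [Fintype.card_sum, Fintype.card_prod, Fintype.card_fin, Fintype.card_unit]
    ring
  · rw [Fintype.card_fin 1, card_skolemIndex (by omega)]
    obtain ⟨s, rfl⟩ : ∃ s, t = s + 1 := ⟨t - 1, by omega⟩
    rw [show 2 * (s + 1) - 1 = 2 * s + 1 by omega]
    symm
    apply schoenheim_eq <;> rw [show (6 * (s + 1) + 1) / 2 = 3 * s + 3 by omega] <;> nlinarith

theorem hasAlternatingMinimumCovering_two_mod_six (ht : 3 ≤ t) :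
    HasAlternatingMinimumCovering (6 * t + 2) := by
  refine hasAlternatingMinimumCovering_succ_of_hole (skolemFamily_linked ht) _
    (Sum.inl_injective.comp (column_injective _)) (skolemFamily_covers (by omega)) fillFour
    fillFour_covers _ (3 * t - 1) (by omega) (by omega) ?_ ?_ ?_
  · simp only [Fintype.card_sum, Fintype.card_prod, Fintype.card_fin, Fintype.card_unit]
    ring
  · simp only [Fintype.card_sum, Fintype.card_prod, Fintype.card_fin, Fintype.card_unit]
    omega
  · have h := card_skolemIndex (t := t) (by omega)
    rw [Fintype.card_fin 3]
    obtain ⟨s, rfl⟩ : ∃ s, t = s + 1 := ⟨t - 1, by omega⟩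
    rw [show 2 * (s + 1) - 1 = 2 * s + 1 by omega] at h
    symm
    apply schoenheim_eq <;> rw [show (6 * (s + 1) + 2) / 2 = 3 * s + 4 by omega] <;>
      rw [show 3 * (s + 1) - 1 = 3 * s + 2 by omega] <;> nlinarith

end Even

end TripleFamily

end PairCovering
-- Assembling the residue classes modulo six
/-- For every `n ≥ 3` there is an alternating hamiltonian minimum `(n,3,2)`-covering, of size
`C(n,3,2) = ⌈n/3 ⌈(n-1)/2⌉⌉`. For `n ≥ 4` the alternating hamiltonian cycle is a genuine one; the
convention for a single block concerns `n = 3` only. -/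
theorem mainTheorem1 (n : ℕ) (hn : 3 ≤ n) :
    ∃ 𝒜 : Finset (Finset (Fin n)),
      PairCovering.IsMinimumCovering 𝒜 ∧
      (𝒜.card : ℤ) = ⌈(n : ℚ) / 3 * (⌈((n : ℚ) - 1) / 2⌉ : ℚ)⌉ ∧
      PairCovering.IsAlternatingHamiltonian 𝒜 ∧
      (4 ≤ n → PairCovering.HasAlternatingHamiltonianCycle
        (PairCovering.blockIntersectionGraph 𝒜) PairCovering.edgeColor) := by
  change PairCovering.HasAlternatingMinimumCovering n
  rcases Nat.lt_or_ge n 15 with h | h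
  · interval_cases n
    · exact PairCovering.hasAlternatingMinimumCovering_three
    · exact PairCovering.hasAlternatingMinimumCovering_four
    · exact PairCovering.hasAlternatingMinimumCovering_five
    · exact PairCovering.hasAlternatingMinimumCovering_six
    · exact PairCovering.hasAlternatingMinimumCovering_seven
    · exact PairCovering.hasAlternatingMinimumCovering_eight
    · exact PairCovering.hasAlternatingMinimumCovering_nine
    · exact PairCovering.hasAlternatingMinimumCovering_ten
    · exact PairCovering.hasAlternatingMinimumCovering_eleven
    · exact PairCovering.hasAlternatingMinimumCovering_twelve
    · exact PairCovering.hasAlternatingMinimumCovering_thirteen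
    · exact PairCovering.hasAlternatingMinimumCovering_fourteen
  -- The last two classes are written with `t + 1` because the Skolem levels have even size `2 * (t
  -- + 1)`, and at least five elements per level are needed.
  · obtain ⟨t, ht, h' | h' | h' | h' | h' | h'⟩ : ∃ t, 2 ≤ t ∧ (n = 6 * t + 3 ∨ n = 6 * t + 4 ∨
        n = 6 * t + 5 ∨ n = 6 * t + 6 ∨ n = 6 * (t + 1) + 1 ∨ n = 6 * (t + 1) + 2) :=
      ⟨(n - 3) / 6, by omega, by omega⟩
    · exact h' ▸ PairCovering.TripleFamily.hasAlternatingMinimumCovering_three_mod_six ht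
    · exact h' ▸ PairCovering.TripleFamily.hasAlternatingMinimumCovering_four_mod_six ht
    · exact h' ▸ PairCovering.TripleFamily.hasAlternatingMinimumCovering_five_mod_six ht
    · exact h' ▸ PairCovering.TripleFamily.hasAlternatingMinimumCovering_zero_mod_six ht
    · exact h' ▸ PairCovering.TripleFamily.hasAlternatingMinimumCovering_one_mod_six (by omega)
    · exact h' ▸ PairCovering.TripleFamily.hasAlternatingMinimumCovering_two_mod_six (by omega)
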